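/- Let $0\le\beta<1$ and $$\mathcal S_\beta=\{\zeta\in\mathbb C^2:\ \operatorname{Im}\zeta_2=|\zeta_1|^2+\beta\operatorname{Re}(\zeta_1^2)\},\qquad \Omega_\beta=\{z\in\mathbb C^2:\ \operatorname{Im}z_2>|z_1|^2+\beta\operatorname{Re}(z_1^2)\}.$$ With $\zeta_j=x_j+iy_j$, equip $\mathcal S_\beta$ with the measure and orientation $\sigma=dx_1\wedge dy_1\wedge dx_2$. Let $\rho(\zeta)=|\zeta_1|^2+\beta\operatorname{Re}(\zeta_1^2)-\operatorname{Im}\zeta_2$. For $f\in L^2(\mathcal S_\beta,\sigma)$ and $z\in\Omega_\beta$ put $$\mathcal L_\beta f(z)=\int_{\mathcal S_\beta} f(\zeta)\,\frac{1}{(2\pi i)^2}\,\frac{\partial\rho(\zeta)\wedge\bar\partial\partial\rho(\zeta)}{\langle\partial\rho(\zeta),\zeta-z\rangle^2},$$ where $\langle\cdot,\cdot\rangle$ is the bilinear pairing of $(1,0)$-forms with vectors. This integral converges absolutely, and there is a bounded linear operator $L_\beta$ on $L^2(\mathcal S_\beta,\sigma)$, the Leray transform of $\mathcal S_\beta$,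 that gives the $L^2$ boundary values: for every $f$, the functions $(z_1,z_2)\mapsto \mathcal L_\beta f(z_1,z_2+i\varepsilon)$ on $\mathcal S_\beta$ converge to $L_\beta f$ in $L^2(\mathcal S_\beta,\sigma)$ as $\varepsilon\to0^+$. Let $W(\mathcal S_\beta)=(\ker L_\beta)^\perp$, let the Hardy space $H^2(\mathcal S_\beta)$ be the range of $L_\beta$, and let $Q_\beta:W(\mathcal S_\beta)\to H^2(\mathcal S_\beta)$ be the restriction of $L_\beta$ to $W(\mathcal S_\beta)$. Then $$\sqrt[4]{1-\beta^2}\;Q_\beta:\ W(\mathcal S_\beta)\to H^2(\mathcal S_\beta)$$ is an isometry of $W(\mathcal S_\beta)$ onto $H^2(\mathcal S_\beta)$ (both with the norm of $L^2(\mathcal S_\beta,\sigma)$). -/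

import Mathlib

open MeasureTheory Filter Topology

noncomputable section

namespace LerayModel

/-- The space `ℂ²`. The coordinates `ζ₁, ζ₂` are `ζ 0` and `ζ 1`. -/
abbrev C2 : Type := Fin 2 → ℂ

/-! ### Forms on `ℂ²` and the Leray kernel of a defining function -/

/-- The Wirtinger derivative `∂F/∂ζⱼ` at `ζ`. -/
def wirt (j : Fin 2) (F : C2 → ℂ) (ζ : C2) : ℂ :=
  (fderiv ℝ F ζ (Pi.single j 1) - Complex.I * fderiv ℝ F ζ (Pi.single j Complex.I)) / 2

/-- The conjugate Wirtinger derivative `∂F/∂ζ̄ⱼ` at `ζ`. -/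
def wirtBar (j : Fin 2) (F : C2 → ℂ) (ζ : C2) : ℂ :=
  (fderiv ℝ F ζ (Pi.single j 1) + Complex.I * fderiv ℝ F ζ (Pi.single j Complex.I)) / 2

/-- The `(1,0)`-form `∂ρ = ∑ⱼ (∂ρ/∂ζⱼ) dζⱼ` at `ζ`, evaluated at a vector `v`
(this is also the bilinear pairing of `∂ρ(ζ)` with `v`). -/
def del (ρ : C2 → ℝ) (ζ v : C2) : ℂ :=
  ∑ j, wirt j (fun η => (ρ η : ℂ)) ζ * v j

/-- The `(1,1)`-form `∂̄∂ρ = ∑ⱼₖ (∂²ρ/∂ζ̄ₖ∂ζⱼ) dζ̄ₖ ∧ dζⱼ` at `ζ`, evaluated at `(u, v)`. -/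
def delBarDel (ρ : C2 → ℝ) (ζ u v : C2) : ℂ :=
  ∑ j, ∑ k, wirtBar k (wirt j (fun η => (ρ η : ℂ))) ζ *
    (star (u k) * v j - star (v k) * u j)

/-- The `3`-form `∂ρ ∧ ∂̄∂ρ` at `ζ`, evaluated at `(u, v, w)`. -/
def delWedge (ρ : C2 → ℝ) (ζ u v w : C2) : ℂ :=
  del ρ ζ u * delBarDel ρ ζ v w - del ρ ζ v * delBarDel ρ ζ u w
    + del ρ ζ w * delBarDel ρ ζ u v

/-- The Leray kernel in `ℂ²` of the hypersurface with defining function `ρ`,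
`(2πi)⁻² (∂ρ(ζ) ∧ ∂̄∂ρ(ζ)) / ⟨∂ρ(ζ), ζ - z⟩²`, a `3`-form in `ζ`, evaluated at `(u, v, w)`. -/
def lerayForm (ρ : C2 → ℝ) (z ζ u v w : C2) : ℂ :=
  1 / (2 * (Real.pi : ℂ) * Complex.I) ^ 2 * (delWedge ρ ζ u v w / del ρ ζ (ζ - z) ^ 2)

/-! ### The model hypersurface, its domain and its measure -/

/-- The hypersurface `S_β = {Im ζ₂ = |ζ₁|² + β Re ζ₁²}`. -/
def S (β : ℝ) : Set C2 :=
  {ζ | (ζ 1).im = ‖ζ 0‖ ^ 2 + β * ((ζ 0) ^ 2).re}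

/-- The domain `Ω_β = {Im z₂ > |z₁|² + β Re z₁²}`. -/
def Omega (β : ℝ) : Set C2 :=
  {z | (z 1).im > ‖z 0‖ ^ 2 + β * ((z 0) ^ 2).re}

/-- The defining function of `S_β`, negative exactly on `Ω_β`. -/
def rho (β : ℝ) (ζ : C2) : ℝ :=
  ‖ζ 0‖ ^ 2 + β * ((ζ 0) ^ 2).re - (ζ 1).im

/-- The graph map `(x₁ + i y₁, x₂) ↦ (ζ₁, ζ₂)` parametrizing `S_β`. -/
def graph (β : ℝ) (p : ℂ × ℝ) : C2 :=
  ![p.1, (p.2 : ℂ) + ((‖p.1‖ ^ 2 + β * (p.1 ^ 2).re : ℝ) : ℂ) * Complex.I]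

theorem graph_mem (β : ℝ) (p : ℂ × ℝ) : graph β p ∈ S β := by
  simp [graph, S, -Complex.ofReal_add, -Complex.ofReal_mul]

/-- The measure `σ = dx₁ ∧ dy₁ ∧ dx₂` on `S_β`. -/
def sigma (β : ℝ) : Measure (S β) :=
  Measure.map (fun p : ℂ × ℝ => (⟨graph β p, graph_mem β p⟩ : S β)) volume

/-- The tangent vector to `S_β` at `ζ` that has the components `a` in the coordinates
`(x₁ + i y₁, x₂)`. -/
def tangent (β : ℝ) (ζ : C2) (a : ℂ × ℝ) : C2 :=
  fderiv ℝ (graph β) (ζ 0, (ζ 1).re) a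

/-- The coefficient `ℓ_β(z, ζ)` of the Leray kernel of `S_β` with respect to
`dx₁ ∧ dy₁ ∧ dx₂`: the value of the kernel at `∂/∂x₁, ∂/∂y₁, ∂/∂x₂`. -/
def ell (β : ℝ) (z ζ : C2) : ℂ :=
  lerayForm (rho β) z ζ
    (tangent β ζ (1, 0)) (tangent β ζ (Complex.I, 0)) (tangent β ζ (0, 1))

/-! ### The Leray transform on `L²(S_β, σ)` -/

/-- The Hilbert space `L²(S_β, σ)`. -/
abbrev L2S (β : ℝ) : Type := Lp ℂ 2 (sigma β)

/-- The Leray integral of `f` at a point `z` (of `Ω_β`). -/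
def lerayIntegral (β : ℝ) (f : S β → ℂ) (z : C2) : ℂ :=
  ∫ ζ : S β, f ζ * ell β z ζ ∂(sigma β)

/-- `L` is the Leray transform of `S_β` as an operator on `L²(S_β, σ)`: for every `f` the Leray
integral converges absolutely on `Ω_β`, and `L f` is its `L²` boundary value, that is,
`z ↦ (Leray integral of f)(z₁, z₂ + iε)` tends to `L f` in `L²(S_β, σ)` as `ε` decreases to `0`. -/
def IsLerayTransform (β : ℝ) (L : L2S β →L[ℂ] L2S β) : Prop :=
  ∀ f : L2S β,
    (∀ z ∈ Omega β, Integrable (fun ζ : S β => f ζ * ell β z ζ) (sigma β)) ∧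
    Tendsto
      (fun ε : ℝ => eLpNorm
        (fun z : S β => lerayIntegral β f ((z : C2) + ![0, (ε : ℂ) * Complex.I]) - L f z)
        2 (sigma β))
      (𝓝[>] 0) (𝓝 0)

open Classical in
/-- The Leray transform `L_β : L²(S_β, σ) → L²(S_β, σ)` (the value `0` is taken only if no
operator is the Leray transform). -/
def lerayTransform (β : ℝ) : L2S β →L[ℂ] L2S β :=
  if h : ∃ L : L2S β →L[ℂ] L2S β, IsLerayTransform β L then h.choose else 0

/-- `W(S_β) = (ker L_β)^⊥`. -/
def W (β : ℝ) : Submodule ℂ (L2S β) :=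
  (LinearMap.ker (lerayTransform β : L2S β →ₗ[ℂ] L2S β))ᗮ

/-- The Hardy space `H²(S_β)`, the range of `L_β`. -/
def H2 (β : ℝ) : Submodule ℂ (L2S β) :=
  LinearMap.range (lerayTransform β : L2S β →ₗ[ℂ] L2S β)

/-- `Q_β : W(S_β) → H²(S_β)`, the restriction of `L_β` to `W(S_β)`. -/
def Q (β : ℝ) : W β →L[ℂ] H2 β :=
  ((lerayTransform β).comp (W β).subtypeL).codRestrict (H2 β)
    (fun f => LinearMap.mem_range_self (lerayTransform β : L2S β →ₗ[ℂ] L2S β) (f : L2S β))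

end LerayModel

end

/-!
The hypersurface `S_β` is invariant under translations in `x₂`, and the Leray kernel depends on
`x₂` only through `2⟨∂ρ(ζ), ζ - z⟩ = Φ(z₁, ζ₁) + ε + i (x₂ - u)`, where
`Re Φ(z, w) = (1 + β) Re(w - z)² + (1 - β) Im(w - z)²`. Since `A⁻²` is a Laplace integral
`∫₀^∞ s e^{-2πsA} ds` up to a constant, the partial Fourier transform in `x₂` turns the Leray
integral at height `ε` into the factor `e^{-2πεs}` times the integral operator on `ℂ` with kernel
`4s e^{-2πsΦ(z, w)}` at each frequency `s > 0`, and into `0` for `s ≤ 0`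
(`integral_mul_modelKernel_eq_partialFourier`). These kernels are dominated by Gaussians whose mass
does not depend on `s`, so by Schur's test they define a bounded operator `T`, and dominated
convergence as `ε → 0` shows that the Leray transform exists and is unitarily equivalent to `T`
(`tendsto_integral_mul_modelKernel`).

The isometry is a computation with Gaussian integrals. The kernel of `√(1 - β²) T T†` is the
Bargmann–Fock projection kernel, conjugated by a unimodular function
(`integral_leviPhase_mul_conj`), and this projection reproduces the functions `z ↦ e^{-2πsΦ(z, w)}`
(`integral_fockPhase_mul_leviPhase`). Hence `√(1 - β²) T T† T = T`, so that `√(1 - β²) T† T` is the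
identity on `(ker T)ᗮ`, that is, `√(1 - β²) ‖T f‖² = ‖f‖²` there
(`mul_norm_sq_eq_of_mem_orthogonal_ker`).
-/

noncomputable section

namespace LerayModel

open scoped FourierTransform SchwartzMap ENNReal NNReal ComplexConjugate

/-! ### Plancherel's formula and the partial Fourier integral -/

section

open scoped ContDiff in
/-- On `L¹ ∩ L²` the Fourier integral agrees with the Fourier transform on `L²`: both have the same
pairing with test functions. -/
theorem fourier_toLp_ae {f : ℝ → ℂ} (hf : Integrable f) (hf2 : MemLp f 2) :
    𝓕 f =ᵐ[volume] (𝓕 (hf2.toLp f) : Lp ℂ 2 (volume : Measure ℝ)) := by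
  refine ae_eq_of_integral_contDiff_smul_eq ?_ ?_ ?_
  · exact (VectorFourier.fourierIntegral_continuous Real.continuous_fourierChar
      (by fun_prop) hf).locallyIntegrable
  · exact (Lp.memLp _).locallyIntegrable (by norm_num)
  intro g hg hgs
  have h1 : HasCompactSupport (fun x => (g x : ℂ)) := hgs.comp_left Complex.ofReal_zero
  have h2 : ContDiff ℝ ∞ (fun x => (g x : ℂ)) := Complex.ofRealCLM.contDiff.comp hg
  let φ : 𝓢(ℝ, ℂ) := h1.toSchwartzMap h2
  have hφ : ∀ x, φ x = (g x : ℂ) := fun x => rfl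
  have key := congrArg (fun T => T φ) (Lp.fourier_toTemperedDistribution_eq (hf2.toLp f))
  simp only [TemperedDistribution.fourier_apply, Lp.toTemperedDistribution_apply] at key
  calc ∫ x, g x • 𝓕 f x = ∫ x, φ x • 𝓕 f x := by simp [hφ]
    _ = ∫ x, 𝓕 (φ : ℝ → ℂ) x • f x := by
      have h := VectorFourier.integral_fourierIntegral_smul_eq_flip (μ := volume) (ν := volume)
        (L := innerₗ ℝ) Real.continuous_fourierChar (by fun_prop) (φ.integrable (μ := volume)) hf
      rw [flip_innerₗ] at h
      exact h.symm
    _ = ∫ x, (𝓕 φ) x • (hf2.toLp f) x := by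
      refine integral_congr_ae ?_
      filter_upwards [hf2.coeFn_toLp] with x hx
      rw [hx, SchwartzMap.fourier_coe]
    _ = ∫ x, φ x • (𝓕 (hf2.toLp f) : Lp ℂ 2 (volume : Measure ℝ)) x := key
    _ = _ := by simp [hφ]

theorem eLpNorm_two_eq_lintegral {α : Type*} [MeasurableSpace α] (μ : Measure α) (f : α → ℂ) :
    eLpNorm f 2 μ = (∫⁻ x, ‖f x‖ₑ ^ 2 ∂μ) ^ (1 / 2 : ℝ) := by
  rw [eLpNorm_eq_lintegral_rpow_enorm_toReal (by norm_num) (by norm_num)]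
  norm_num

/-- Plancherel's formula for the Fourier integral of a function in `L¹ ∩ L²`. -/
theorem lintegral_fourier_sq {f : ℝ → ℂ} (hf : Integrable f) (hf2 : MemLp f 2) :
    ∫⁻ u, ‖𝓕 f u‖ₑ ^ 2 = ∫⁻ s, ‖f s‖ₑ ^ 2 := by
  have h1 : eLpNorm (𝓕 f) 2 volume = eLpNorm f 2 volume := by
    rw [eLpNorm_congr_ae (fourier_toLp_ae hf hf2), ← eLpNorm_congr_ae hf2.coeFn_toLp]
    have := Lp.norm_fourier_eq (hf2.toLp f)
    rw [Lp.norm_def, Lp.norm_def] at this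
    exact (ENNReal.toReal_eq_toReal_iff' (Lp.eLpNorm_ne_top _) (Lp.eLpNorm_ne_top _)).1 this
  rw [eLpNorm_two_eq_lintegral, eLpNorm_two_eq_lintegral] at h1
  exact ENNReal.rpow_left_injective (by norm_num : (1 / 2 : ℝ) ≠ 0) h1

/-- The Fourier integral dilated by `σ` is, in the sesquilinear pairing, adjoint to the one
dilated by `-σ`. -/
theorem integral_conj_fourier_mul {g h : ℝ → ℂ} (hg : Integrable g) (hh : Integrable h) (σ : ℝ) :
    ∫ u, star (𝓕 g (σ * u)) * h u = ∫ s, star (g s) * 𝓕 h (-σ * s) := by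
  have key := VectorFourier.integral_sesq_fourierIntegral_eq_neg_flip (μ := volume) (ν := volume)
    (L := σ • innerₗ ℝ) (innerSL ℂ (E := ℂ)) Real.continuous_fourierChar (by fun_prop) hg hh
  simp only [innerSL_apply_apply, RCLike.inner_apply'] at key
  have h1 : ∀ u, VectorFourier.fourierIntegral Real.fourierChar volume (σ • innerₗ ℝ) g u =
      𝓕 g (σ * u) := by
    intro u
    rw [Real.fourier_eq, VectorFourier.fourierIntegral]
    refine integral_congr_ae (.of_forall fun v => ?_)
    simp [mul_left_comm, mul_comm]
  have h2 : ∀ u, VectorFourier.fourierIntegral Real.fourierChar volume (-(σ • innerₗ ℝ).flip) h u =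
      𝓕 h (-σ * u) := by
    intro u
    rw [Real.fourier_eq, VectorFourier.fourierIntegral]
    refine integral_congr_ae (.of_forall fun v => ?_)
    simp [mul_left_comm, mul_comm]
  simp only [h1, h2] at key
  exact key

variable {X : Type*} [MeasurableSpace X] {μ : Measure X}

/-- The Fourier integral of `G` in its last variable, dilated by `σ`. The values `σ = 1` and
`σ = -1` give the partial Fourier transform and its inverse. -/
def partialFourier (σ : ℝ) (G : X × ℝ → ℂ) (p : X × ℝ) : ℂ :=
  𝓕 (fun s => G (p.1, s)) (σ * p.2)

theorem stronglyMeasurable_partialFourier (σ : ℝ) {G : X × ℝ → ℂ} (hG : StronglyMeasurable G) :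
    StronglyMeasurable (partialFourier σ G) := by
  unfold partialFourier
  simp only [Real.fourier_eq, Circle.smul_def, smul_eq_mul]
  have : StronglyMeasurable (fun q : (X × ℝ) × ℝ =>
      ((Real.fourierChar (-inner ℝ q.2 (σ * q.1.2)) : Circle) : ℂ) * G (q.1.1, q.2)) := by
    refine StronglyMeasurable.mul ?_ ?_
    · have : Continuous fun t : ℝ => ((Real.fourierChar (-t) : Circle) : ℂ) := by fun_prop
      exact this.comp_stronglyMeasurable (Measurable.stronglyMeasurable (by fun_prop))
    · exact hG.comp_measurable (by fun_prop)
  exact this.integral_prod_right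

theorem memLp_two_of_lintegral {α : Type*} [MeasurableSpace α] {ν : Measure α} {f : α → ℂ}
    (hf : AEStronglyMeasurable f ν) (h : ∫⁻ x, ‖f x‖ₑ ^ 2 ∂ν ≠ ∞) : MemLp f 2 ν :=
  ⟨hf, by rw [eLpNorm_two_eq_lintegral]; exact ENNReal.rpow_lt_top_of_nonneg (by norm_num) h⟩

theorem lintegral_ne_top_of_memLp_two {α : Type*} [MeasurableSpace α] {ν : Measure α} {f : α → ℂ}
    (h : MemLp f 2 ν) : ∫⁻ x, ‖f x‖ₑ ^ 2 ∂ν ≠ ∞ := by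
  intro h0
  have := h.2
  rw [eLpNorm_two_eq_lintegral, h0] at this
  simp at this

theorem ae_memLp_slice {G : X × ℝ → ℂ} (hG : MemLp G 2 (μ.prod volume)) :
    ∀ᵐ x ∂μ, MemLp (fun s => G (x, s)) 2 := by
  have h := lintegral_ne_top_of_memLp_two hG
  rw [lintegral_prod _ (by have := hG.1.aemeasurable; fun_prop)] at h
  have h2 := ae_lt_top' (by
    exact AEMeasurable.lintegral_prod_right' (f := fun p : X × ℝ => ‖G p‖ₑ ^ 2)
      (by have := hG.1.aemeasurable; fun_prop)) h
  filter_upwards [h2, hG.1.prodMk_left] with x hx hx'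
  exact memLp_two_of_lintegral hx' hx.ne

theorem partialFourier_congr (σ : ℝ) {F G : X × ℝ → ℂ} (h : F =ᵐ[μ.prod volume] G) :
    ∀ᵐ x ∂μ, ∀ u, partialFourier σ F (x, u) = partialFourier σ G (x, u) := by
  filter_upwards [Measure.ae_ae_of_ae_prod h] with x hx u
  exact Real.fourier_congr_ae hx _

theorem partialFourier_ae_congr {σ : ℝ} {F G : X × ℝ → ℂ} (h : ∀ᵐ x ∂μ, ∀ u,
    partialFourier σ F (x, u) = partialFourier σ G (x, u)) :
    partialFourier σ F =ᵐ[μ.prod volume] partialFourier σ G := by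
  filter_upwards [Measure.quasiMeasurePreserving_fst.ae h] with p hp using hp p.2

/-- Plancherel's formula in every slice, integrated over the slices. -/
theorem lintegral_partialFourier_sq {σ : ℝ} (hσ : |σ| = 1) {G : X × ℝ → ℂ}
    (hGm : StronglyMeasurable G) (hG : MemLp G 2 (μ.prod volume))
    (hG1 : ∀ᵐ x ∂μ, Integrable (fun s => G (x, s))) :
    ∫⁻ p, ‖partialFourier σ G p‖ₑ ^ 2 ∂(μ.prod volume) = ∫⁻ p, ‖G p‖ₑ ^ 2 ∂(μ.prod volume) := by
  have hσ0 : σ ≠ 0 := by rintro rfl; simp at hσ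
  rw [lintegral_prod _ (by
    have := (stronglyMeasurable_partialFourier σ hGm).measurable; fun_prop),
    lintegral_prod _ (by have := hGm.measurable; fun_prop)]
  refine lintegral_congr_ae ?_
  filter_upwards [hG1, ae_memLp_slice hG] with x h1 h2
  rw [← lintegral_fourier_sq h1 h2]
  have hc : Measurable (fun u => ‖𝓕 (fun s => G (x, s)) u‖ₑ ^ 2) := by
    have : Continuous (𝓕 (fun s => G (x, s))) :=
      VectorFourier.fourierIntegral_continuous Real.continuous_fourierChar (by fun_prop) h1
    have := this.measurable
    fun_prop
  have h := lintegral_map (μ := volume) hc (measurable_const_mul σ)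
  rw [Real.map_volume_mul_left hσ0, lintegral_smul_measure, abs_inv, hσ] at h
  simpa [partialFourier] using h.symm

variable (μ) in
/-- The functions in `L²` whose slices in the last variable are integrable: a dense subspace on
which the partial Fourier transform is given by an integral. -/
def sliceIntegrable : Submodule ℂ (Lp ℂ 2 (μ.prod (volume : Measure ℝ))) where
  carrier := {G | ∀ᵐ x ∂μ, Integrable (fun s => G (x, s))}
  zero_mem' := by
    filter_upwards [Measure.ae_ae_of_ae_prod (Lp.coeFn_zero ℂ 2 (μ.prod (volume : Measure ℝ)))]
      with x hx
    exact (integrable_zero ℝ ℂ volume).congr (EventuallyEq.symm hx)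
  add_mem' := by
    intro F G hF hG
    change ∀ᵐ x ∂μ, _
    filter_upwards [Measure.ae_ae_of_ae_prod (Lp.coeFn_add F G), hF, hG] with x hx h1 h2
    exact (h1.add h2).congr (EventuallyEq.symm hx)
  smul_mem' := by
    intro c F hF
    change ∀ᵐ x ∂μ, _
    filter_upwards [Measure.ae_ae_of_ae_prod (Lp.coeFn_smul c F), hF] with x hx h1
    exact (h1.smul c).congr (EventuallyEq.symm hx)

theorem memLp_partialFourier {σ : ℝ} (hσ : |σ| = 1) (G : sliceIntegrable μ) :
    MemLp (partialFourier σ (G : Lp ℂ 2 (μ.prod volume))) 2 (μ.prod volume) := by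
  refine memLp_two_of_lintegral
    (stronglyMeasurable_partialFourier σ (Lp.stronglyMeasurable _)).aestronglyMeasurable ?_
  rw [lintegral_partialFourier_sq hσ (Lp.stronglyMeasurable _) (Lp.memLp _) G.2]
  exact lintegral_ne_top_of_memLp_two (Lp.memLp _)

theorem toLp_mem_sliceIntegrable {G : X × ℝ → ℂ} (hG : MemLp G 2 (μ.prod volume))
    (h1 : ∀ᵐ x ∂μ, Integrable (fun s => G (x, s))) : hG.toLp G ∈ sliceIntegrable μ := by
  change ∀ᵐ x ∂μ, _
  filter_upwards [h1, Measure.ae_ae_of_ae_prod hG.coeFn_toLp] with x h1 h2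
  exact h1.congr (EventuallyEq.symm h2)

variable [SFinite μ]

/-- Simple functions in `L²` are integrable, hence have integrable slices. -/
theorem dense_sliceIntegrable :
    Dense (sliceIntegrable μ : Set (Lp ℂ 2 (μ.prod (volume : Measure ℝ)))) := by
  refine (Lp.simpleFunc.dense (p := 2) (by norm_num)).mono ?_
  intro G hG
  have h1 : Integrable (Lp.simpleFunc.toSimpleFunc ⟨G, hG⟩) (μ.prod (volume : Measure ℝ)) :=
    (SimpleFunc.memLp_iff_integrable (by norm_num) (by norm_num)).1
      (Lp.simpleFunc.memLp (⟨G, hG⟩ : Lp.simpleFunc ℂ 2 (μ.prod (volume : Measure ℝ))))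
  have h2 := h1.congr (Lp.simpleFunc.toSimpleFunc_eq_toFun ⟨G, hG⟩)
  exact h2.prod_right_ae

end

/-! ### The partial Fourier transform as a unitary operator -/

section

variable {X : Type*} [MeasurableSpace X] {μ : Measure X}

/-- The partial Fourier transform on the dense subspace on which it is given by an integral. -/
def partialFourierSlice {σ : ℝ} (hσ : |σ| = 1) :
    sliceIntegrable μ →ₗ[ℂ] Lp ℂ 2 (μ.prod (volume : Measure ℝ)) where
  toFun G := (memLp_partialFourier hσ G).toLp _
  map_add' F G := by
    rw [← MemLp.toLp_add, MemLp.toLp_eq_toLp_iff]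
    have h1 := partialFourier_congr σ (Lp.coeFn_add (F : Lp ℂ 2 (μ.prod (volume : Measure ℝ))) G)
    refine (partialFourier_ae_congr
      (F := ⇑((F : Lp ℂ 2 (μ.prod (volume : Measure ℝ))) +
        (G : Lp ℂ 2 (μ.prod (volume : Measure ℝ)))))
      (G := (F : Lp ℂ 2 (μ.prod (volume : Measure ℝ))) +
        (G : Lp ℂ 2 (μ.prod (volume : Measure ℝ)))) h1).trans ?_
    have h2 : ∀ᵐ x ∂μ, Integrable
        (fun s => (F : Lp ℂ 2 (μ.prod (volume : Measure ℝ))) (x, s)) := F.2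
    have h3 : ∀ᵐ x ∂μ, Integrable
        (fun s => (G : Lp ℂ 2 (μ.prod (volume : Measure ℝ))) (x, s)) := G.2
    filter_upwards [Measure.quasiMeasurePreserving_fst.ae h2,
      Measure.quasiMeasurePreserving_fst.ae h3] with p h2 h3
    simp only [partialFourier, Pi.add_apply]
    exact congrFun (VectorFourier.fourierIntegral_add Real.continuous_fourierChar
      (by fun_prop) h2 h3) _
  map_smul' c G := by
    rw [RingHom.id_apply, ← MemLp.toLp_const_smul, MemLp.toLp_eq_toLp_iff]
    have h1 := partialFourier_congr σ (Lp.coeFn_smul c (G : Lp ℂ 2 (μ.prod (volume : Measure ℝ))))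
    refine (partialFourier_ae_congr
      (F := ⇑(c • (G : Lp ℂ 2 (μ.prod (volume : Measure ℝ)))))
      (G := c • ⇑(G : Lp ℂ 2 (μ.prod (volume : Measure ℝ)))) h1).trans (.of_forall fun p => ?_)
    simp only [partialFourier, Pi.smul_apply, Real.fourier_eq, ← integral_smul]
    refine integral_congr_ae (.of_forall fun v => ?_)
    simp only [smul_comm c]

theorem norm_partialFourierSlice {σ : ℝ} (hσ : |σ| = 1) (G : sliceIntegrable μ) :
    ‖partialFourierSlice hσ G‖ = ‖(G : Lp ℂ 2 (μ.prod (volume : Measure ℝ)))‖ := by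
  simp only [partialFourierSlice, LinearMap.coe_mk, AddHom.coe_mk, Lp.norm_toLp]
  rw [Lp.norm_def, eLpNorm_two_eq_lintegral, eLpNorm_two_eq_lintegral,
    lintegral_partialFourier_sq hσ (Lp.stronglyMeasurable _) (Lp.memLp _) G.2]

variable [SFinite μ]

theorem denseRange_sliceIntegrable : DenseRange (sliceIntegrable μ).subtype := by
  have := dense_sliceIntegrable (μ := μ)
  rw [DenseRange]
  convert! this
  simp

/-- The partial Fourier transform `G ↦ ((x, u) ↦ ∫ G(x, s) e^{-2πiσsu} ds)` on `L²`, for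
`σ = ±1`, extended by continuity from the functions with integrable slices. -/
def partialFourierL2 {σ : ℝ} (hσ : |σ| = 1) :
    Lp ℂ 2 (μ.prod (volume : Measure ℝ)) →L[ℂ] Lp ℂ 2 (μ.prod (volume : Measure ℝ)) :=
  (partialFourierSlice hσ).extendOfNorm (sliceIntegrable μ).subtype

theorem partialFourierL2_coe {σ : ℝ} (hσ : |σ| = 1) (G : sliceIntegrable μ) :
    partialFourierL2 hσ (G : Lp ℂ 2 (μ.prod (volume : Measure ℝ))) = partialFourierSlice hσ G :=
  LinearMap.extendOfNorm_eq denseRange_sliceIntegrable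
    ⟨1, fun G => by rw [one_mul]; exact (norm_partialFourierSlice hσ G).le⟩ G

theorem norm_partialFourierL2 {σ : ℝ} (hσ : |σ| = 1) (G : Lp ℂ 2 (μ.prod (volume : Measure ℝ))) :
    ‖partialFourierL2 hσ G‖ = ‖G‖ := by
  refine denseRange_sliceIntegrable.induction_on G (isClosed_eq (by fun_prop) (by fun_prop)) ?_
  intro G
  rw [Submodule.subtype_apply, partialFourierL2_coe, norm_partialFourierSlice]

/-- On functions with integrable slices the partial Fourier transform is the Fourier integral of
the slices. -/
theorem partialFourierL2_toLp {σ : ℝ} (hσ : |σ| = 1) {G : X × ℝ → ℂ}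
    (hG : MemLp G 2 (μ.prod volume)) (h1 : ∀ᵐ x ∂μ, Integrable (fun s => G (x, s))) :
    partialFourierL2 hσ (hG.toLp G) =ᵐ[μ.prod volume] partialFourier σ G := by
  have h := partialFourierL2_coe hσ ⟨hG.toLp G, toLp_mem_sliceIntegrable hG h1⟩
  simp only at h
  rw [h]
  exact (memLp_partialFourier hσ ⟨hG.toLp G, toLp_mem_sliceIntegrable hG h1⟩).coeFn_toLp.trans
    (partialFourier_ae_congr (partialFourier_congr σ hG.coeFn_toLp))

theorem inner_partialFourierSlice {σ : ℝ} (hσ : |σ| = 1) (hσ' : |-σ| = 1)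
    (G H : sliceIntegrable μ) :
    inner ℂ (partialFourierSlice hσ G) (H : Lp ℂ 2 (μ.prod (volume : Measure ℝ))) =
      inner ℂ (G : Lp ℂ 2 (μ.prod (volume : Measure ℝ))) (partialFourierSlice hσ' H) := by
  have hI := L2.integrable_inner (𝕜 := ℂ) (partialFourierSlice hσ G)
    (H : Lp ℂ 2 (μ.prod (volume : Measure ℝ)))
  have hJ := L2.integrable_inner (𝕜 := ℂ) (G : Lp ℂ 2 (μ.prod (volume : Measure ℝ)))
    (partialFourierSlice hσ' H)
  rw [L2.inner_def, L2.inner_def, integral_prod _ hI, integral_prod _ hJ]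
  have h1 : ∀ᵐ x ∂μ, Integrable (fun s => (G : Lp ℂ 2 (μ.prod (volume : Measure ℝ))) (x, s)) := G.2
  have h2 : ∀ᵐ x ∂μ, Integrable (fun s => (H : Lp ℂ 2 (μ.prod (volume : Measure ℝ))) (x, s)) := H.2
  refine integral_congr_ae ?_
  filter_upwards [h1, h2,
    Measure.ae_ae_of_ae_prod (memLp_partialFourier hσ G).coeFn_toLp,
    Measure.ae_ae_of_ae_prod (memLp_partialFourier hσ' H).coeFn_toLp] with x h1 h2 h3 h4
  have h := integral_conj_fourier_mul h1 h2 σ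
  convert h using 1
  · refine integral_congr_ae ?_
    filter_upwards [h3] with u hu
    rw [RCLike.inner_apply', starRingEnd_apply]
    congr 2
  · refine integral_congr_ae ?_
    filter_upwards [h4] with u hu
    rw [RCLike.inner_apply', starRingEnd_apply]
    congr 1

theorem inner_partialFourierL2 {σ : ℝ} (hσ : |σ| = 1) (hσ' : |-σ| = 1)
    (G H : Lp ℂ 2 (μ.prod (volume : Measure ℝ))) :
    inner ℂ (partialFourierL2 hσ G) H = inner ℂ G (partialFourierL2 hσ' H) := by
  refine denseRange_sliceIntegrable.induction_on₂ (p := fun G H =>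
    inner ℂ (partialFourierL2 hσ G) H = inner ℂ G (partialFourierL2 hσ' H))
    (isClosed_eq (by fun_prop) (by fun_prop)) ?_ G H
  intro G H
  simp only [Submodule.subtype_apply, partialFourierL2_coe]
  exact inner_partialFourierSlice hσ hσ' G H

/-- Both transforms are isometric, and they are adjoint to each other. -/
theorem partialFourierL2_neg_apply {σ : ℝ} (hσ : |σ| = 1) (hσ' : |-σ| = 1)
    (G : Lp ℂ 2 (μ.prod (volume : Measure ℝ))) :
    partialFourierL2 hσ' (partialFourierL2 hσ G) = G := by
  refine ext_inner_left ℂ fun H => ?_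
  rw [← inner_partialFourierL2 hσ hσ']
  exact (LinearMap.norm_map_iff_inner_map_map (partialFourierL2 hσ)).1
    (norm_partialFourierL2 hσ) H G

variable (μ) in
/-- The partial Fourier transform as a unitary operator on `L²`. -/
def partialFourierEquiv :
    Lp ℂ 2 (μ.prod (volume : Measure ℝ)) ≃ₗᵢ[ℂ] Lp ℂ 2 (μ.prod (volume : Measure ℝ)) where
  toFun := partialFourierL2 (σ := 1) (by simp)
  invFun := partialFourierL2 (σ := -1) (by simp)
  left_inv G := partialFourierL2_neg_apply _ _ G
  right_inv G := by
    have := partialFourierL2_neg_apply (σ := -1) (by simp) (by simp) G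
    simpa using this
  map_add' := map_add _
  map_smul' := map_smul _
  norm_map' := norm_partialFourierL2 _

end

/-! ### Schur's test on one fibre -/

section Schur

variable {X : Type*} [MeasurableSpace X] {μ : Measure X}

theorem lintegral_mul_sq_le {a b : X → ℝ≥0∞} (ha : AEMeasurable a μ) (hb : AEMeasurable b μ) :
    (∫⁻ x, a x * b x ∂μ) ^ 2 ≤ (∫⁻ x, a x ∂μ) * ∫⁻ x, a x * b x ^ 2 ∂μ := by
  have h := ENNReal.lintegral_mul_norm_pow_le ha (ha.mul (hb.pow_const 2))
    (p := 1 / 2) (q := 1 / 2) (by norm_num) (by norm_num) (by norm_num)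
  have h1 : ∀ x, a x ^ (1 / 2 : ℝ) * (a x * b x ^ 2) ^ (1 / 2 : ℝ) = a x * b x := by
    intro x
    rw [ENNReal.mul_rpow_of_nonneg _ _ (by norm_num), ← mul_assoc,
      ← ENNReal.rpow_add_of_nonneg _ _ (by norm_num) (by norm_num), ← ENNReal.rpow_natCast,
      ← ENNReal.rpow_mul]
    norm_num
  simp only [Pi.mul_apply, h1] at h
  calc (∫⁻ x, a x * b x ∂μ) ^ 2 ≤ _ := pow_le_pow_left' h 2
    _ = _ := by
      rw [mul_pow, ← ENNReal.rpow_natCast, ← ENNReal.rpow_natCast, ← ENNReal.rpow_mul,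
        ← ENNReal.rpow_mul]
      norm_num

/-- **Schur's test**, for a nonnegative kernel. -/
theorem lintegral_schur_le [SFinite μ] {κ : X → X → ℝ≥0∞} (hκ : Measurable (Function.uncurry κ))
    {C : ℝ≥0∞} (h1 : ∀ z, ∫⁻ w, κ z w ∂μ ≤ C) (h2 : ∀ w, ∫⁻ z, κ z w ∂μ ≤ C)
    {f : X → ℝ≥0∞} (hf : AEMeasurable f μ) :
    ∫⁻ z, (∫⁻ w, κ z w * f w ∂μ) ^ 2 ∂μ ≤ C ^ 2 * ∫⁻ w, f w ^ 2 ∂μ := by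
  calc ∫⁻ z, (∫⁻ w, κ z w * f w ∂μ) ^ 2 ∂μ
      ≤ ∫⁻ z, C * ∫⁻ w, κ z w * f w ^ 2 ∂μ ∂μ := by
        refine lintegral_mono fun z => (lintegral_mul_sq_le ?_ hf).trans ?_
        · exact (hκ.comp measurable_prodMk_left).aemeasurable
        · gcongr; exact h1 z
    _ ≤ C * ∫⁻ z, ∫⁻ w, κ z w * f w ^ 2 ∂μ ∂μ := by
        rw [lintegral_const_mul'']
        refine AEMeasurable.lintegral_prod_right' (f := fun p : X × X => κ p.1 p.2 * f p.2 ^ 2) ?_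
        exact hκ.aemeasurable.mul (hf.comp_snd.pow_const 2)
    _ = C * ∫⁻ w, ∫⁻ z, κ z w * f w ^ 2 ∂μ ∂μ := by
        rw [lintegral_lintegral_swap]
        exact hκ.aemeasurable.mul (hf.comp_snd.pow_const 2)
    _ ≤ C * ∫⁻ w, C * f w ^ 2 ∂μ := by
        gcongr with w
        have hm : Measurable fun z => κ z w := hκ.comp measurable_prodMk_right
        rw [lintegral_mul_const _ hm]
        gcongr; exact h2 w
    _ = C ^ 2 * ∫⁻ w, f w ^ 2 ∂μ := by
        rw [lintegral_const_mul'' _ (hf.pow_const 2)]; ring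

/-- The two bounds of Schur's test for the kernel `κ`, together with its measurability. -/
structure SchurKernel (μ : Measure X) (C : ℝ≥0) (κ : X → X → ℂ) : Prop where
  measurable : Measurable (Function.uncurry κ)
  left : ∀ z, ∫⁻ w, ‖κ z w‖ₑ ∂μ ≤ C
  right : ∀ w, ∫⁻ z, ‖κ z w‖ₑ ∂μ ≤ C

namespace SchurKernel

variable {C C' : ℝ≥0} {κ κ' : X → X → ℂ}

theorem measurable_left (hκ : SchurKernel μ C κ) (z : X) : Measurable (κ z) :=
  hκ.measurable.comp measurable_prodMk_left

theorem adjoint (hκ : SchurKernel μ C κ) : SchurKernel μ C (fun z w => star (κ w z)) where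
  measurable := (continuous_star.measurable.comp hκ.measurable).comp measurable_swap
  left z := by simpa using hκ.right z
  right w := by simpa using hκ.left w

variable [SFinite μ]

theorem lintegral_sq_le (hκ : SchurKernel μ C κ) {f : X → ℝ≥0∞} (hf : AEMeasurable f μ) :
    ∫⁻ z, (∫⁻ w, ‖κ z w‖ₑ * f w ∂μ) ^ 2 ∂μ ≤ C ^ 2 * ∫⁻ w, f w ^ 2 ∂μ :=
  lintegral_schur_le (κ := fun z w => ‖κ z w‖ₑ) hκ.measurable.enorm hκ.left hκ.right hf

theorem lintegral_sq_ne_top (hκ : SchurKernel μ C κ) {f : X → ℝ≥0∞} (hf : AEMeasurable f μ)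
    (h : ∫⁻ w, f w ^ 2 ∂μ ≠ ∞) : ∫⁻ z, (∫⁻ w, ‖κ z w‖ₑ * f w ∂μ) ^ 2 ∂μ ≠ ∞ :=
  ((hκ.lintegral_sq_le hf).trans_lt
    (ENNReal.mul_lt_top (ENNReal.pow_lt_top ENNReal.coe_lt_top) h.lt_top)).ne

theorem aemeasurable_lintegral (hκ : SchurKernel μ C κ) {f : X → ℝ≥0∞} (hf : AEMeasurable f μ) :
    AEMeasurable (fun z => ∫⁻ w, ‖κ z w‖ₑ * f w ∂μ) μ :=
  AEMeasurable.lintegral_prod_right' (f := fun p : X × X => ‖κ p.1 p.2‖ₑ * f p.2)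
    (hκ.measurable.enorm.aemeasurable.mul hf.comp_snd)

theorem ae_lintegral_lt_top (hκ : SchurKernel μ C κ) {f : X → ℝ≥0∞} (hf : AEMeasurable f μ)
    (h : ∫⁻ w, f w ^ 2 ∂μ ≠ ∞) : ∀ᵐ z ∂μ, ∫⁻ w, ‖κ z w‖ₑ * f w ∂μ < ∞ := by
  filter_upwards [ae_lt_top' ((hκ.aemeasurable_lintegral hf).pow_const 2)
    (hκ.lintegral_sq_ne_top hf h)] with z hz
  simpa using hz

/-- The integral operators with the kernels `κ(z, w)` and `star (κ(w, z))` are adjoint. -/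
theorem integral_conj_mul (hκ : SchurKernel μ C κ) {f g : X → ℂ} (hf : MemLp f 2 μ)
    (hg : MemLp g 2 μ) :
    ∫ z, star (∫ w, κ z w * f w ∂μ) * g z ∂μ =
      ∫ w, star (f w) * ∫ z, star (κ z w) * g z ∂μ ∂μ := by
  have hf' := hf.1.aemeasurable
  have hg' := hg.1.aemeasurable
  have hI : Integrable (Function.uncurry fun z w => star (κ z w) * star (f w) * g z)
      (μ.prod μ) := by
    have hm : AEStronglyMeasurable (Function.uncurry fun z w => star (κ z w) * star (f w) * g z)
        (μ.prod μ) := by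
      refine AEStronglyMeasurable.mul (.mul ?_ ?_) ?_
      · exact (continuous_star.measurable.comp hκ.measurable).aestronglyMeasurable
      · exact continuous_star.comp_aestronglyMeasurable hf.1.comp_snd
      · exact hg.1.comp_fst
    refine ⟨hm, ?_⟩
    rw [hasFiniteIntegral_iff_enorm, lintegral_prod _ hm.enorm]
    calc ∫⁻ z, ∫⁻ w, ‖star (κ z w) * star (f w) * g z‖ₑ ∂μ ∂μ
        = ∫⁻ z, (∫⁻ w, ‖κ z w‖ₑ * ‖f w‖ₑ ∂μ) * ‖g z‖ₑ ∂μ := by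
          refine lintegral_congr fun z => ?_
          rw [← lintegral_mul_const' _ _ enorm_ne_top]
          simp [enorm_mul]
      _ ≤ (∫⁻ z, (∫⁻ w, ‖κ z w‖ₑ * ‖f w‖ₑ ∂μ) ^ (2 : ℝ) ∂μ) ^ (1 / 2 : ℝ) *
            (∫⁻ z, ‖g z‖ₑ ^ (2 : ℝ) ∂μ) ^ (1 / 2 : ℝ) :=
          ENNReal.lintegral_mul_le_Lp_mul_Lq μ Real.HolderConjugate.two_two
            (hκ.aemeasurable_lintegral hf'.enorm) hg'.enorm
      _ < ∞ := by
          refine ENNReal.mul_lt_top (ENNReal.rpow_lt_top_of_nonneg (by norm_num) ?_)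
            (ENNReal.rpow_lt_top_of_nonneg (by norm_num) ?_)
          · simpa using hκ.lintegral_sq_ne_top hf'.enorm (lintegral_ne_top_of_memLp_two hf)
          · simpa using lintegral_ne_top_of_memLp_two hg
  calc ∫ z, star (∫ w, κ z w * f w ∂μ) * g z ∂μ
      = ∫ z, ∫ w, star (κ z w) * star (f w) * g z ∂μ ∂μ := by
        refine integral_congr_ae (.of_forall fun z => ?_)
        simp only [integral_mul_const]
        congr 1
        rw [← starRingEnd_apply, ← integral_conj]
        simp
    _ = ∫ w, ∫ z, star (κ z w) * star (f w) * g z ∂μ ∂μ := integral_integral_swap hI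
    _ = _ := by
        refine integral_congr_ae (.of_forall fun w => ?_)
        simp only [← integral_const_mul]
        exact integral_congr_ae (.of_forall fun z => by ring)

/-- The composition of two integral operators has the composed kernel. -/
theorem ae_integral_integral (hκ : SchurKernel μ C κ) (hκ' : SchurKernel μ C' κ') {f : X → ℂ}
    (hf : MemLp f 2 μ) :
    ∀ᵐ z ∂μ, ∫ a, κ z a * ∫ w, κ' a w * f w ∂μ ∂μ =
      ∫ w, (∫ a, κ z a * κ' a w ∂μ) * f w ∂μ := by
  have hf' := hf.1.aemeasurable
  have hfin := lintegral_ne_top_of_memLp_two hf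
  filter_upwards [hκ.ae_lintegral_lt_top (hκ'.aemeasurable_lintegral hf'.enorm)
    (hκ'.lintegral_sq_ne_top hf'.enorm hfin)] with z hz
  have hI : Integrable (Function.uncurry fun a w => κ z a * κ' a w * f w) (μ.prod μ) := by
    have hm : AEStronglyMeasurable (Function.uncurry fun a w => κ z a * κ' a w * f w)
        (μ.prod μ) := by
      refine AEStronglyMeasurable.mul (.mul ?_ ?_) ?_
      · exact ((hκ.measurable_left z).comp measurable_fst).aestronglyMeasurable
      · exact hκ'.measurable.aestronglyMeasurable
      · exact hf.1.comp_snd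
    refine ⟨hm, ?_⟩
    rw [hasFiniteIntegral_iff_enorm, lintegral_prod _ hm.enorm]
    refine lt_of_eq_of_lt (lintegral_congr fun a => ?_) hz
    rw [← lintegral_const_mul' _ _ enorm_ne_top]
    simp [enorm_mul, mul_assoc]
  calc ∫ a, κ z a * ∫ w, κ' a w * f w ∂μ ∂μ
      = ∫ a, ∫ w, κ z a * κ' a w * f w ∂μ ∂μ := by
        simp only [← integral_const_mul, mul_assoc]
    _ = ∫ w, ∫ a, κ z a * κ' a w * f w ∂μ ∂μ := integral_integral_swap hI
    _ = _ := by simp only [integral_mul_const]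

end SchurKernel

end Schur

/-! ### Fibrewise integral operators on `L²(X × Y)` -/

section Fibre

variable {X Y : Type*} [MeasurableSpace X] [MeasurableSpace Y] {μ : Measure X} {ν : Measure Y}

/-- A measurable family of kernels on `X`, indexed by `y`, that satisfy Schur's test with a common
constant. -/
structure FibreKernel (μ : Measure X) (C : ℝ≥0) (k : Y → X → X → ℂ) : Prop where
  measurable : Measurable fun q : (X × Y) × X => k q.1.2 q.1.1 q.2
  schur : ∀ y, SchurKernel μ C (k y)

/-- The integral operators with kernels `k y`, applied to the slices `F (·, y)`. -/
def fibreIntegral (μ : Measure X) (k : Y → X → X → ℂ) (F : X × Y → ℂ) (p : X × Y) : ℂ :=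
  ∫ w, k p.2 p.1 w * F (w, p.2) ∂μ

theorem fibreIntegral_congr {Z : Type*} {k : Z → X → X → ℂ} {F G : X × Z → ℂ} (y : Z)
    (h : ∀ᵐ x ∂μ, F (x, y) = G (x, y)) (z : X) :
    fibreIntegral μ k F (z, y) = fibreIntegral μ k G (z, y) := by
  refine integral_congr_ae ?_
  filter_upwards [h] with x hx
  simp only [hx]

theorem FibreKernel.adjoint {C : ℝ≥0} {k : Y → X → X → ℂ} (hk : FibreKernel μ C k) :
    FibreKernel μ C (fun y z w => star (k y w z)) where
  measurable := by
    have : Measurable fun q : (X × Y) × X => ((q.2, q.1.2), q.1.1) := by fun_prop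
    exact continuous_star.measurable.comp (hk.measurable.comp this)
  schur y := (hk.schur y).adjoint

variable [SFinite μ] [SFinite ν]

theorem ae_ae_snd_of_ae_prod {p : X × Y → Prop} (h : ∀ᵐ q ∂(μ.prod ν), p q) :
    ∀ᵐ y ∂ν, ∀ᵐ x ∂μ, p (x, y) := by
  have h' : ∀ᵐ q ∂(ν.prod μ), p q.swap := Measure.measurePreserving_swap.quasiMeasurePreserving.ae h
  exact Measure.ae_ae_of_ae_prod h'

theorem ae_memLp_slice_snd {G : X × Y → ℂ} (hG : MemLp G 2 (μ.prod ν)) :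
    ∀ᵐ y ∂ν, MemLp (fun x => G (x, y)) 2 μ := by
  have hG' := hG.comp_measurePreserving (Measure.measurePreserving_swap (μ := ν) (ν := μ))
  have h := lintegral_ne_top_of_memLp_two hG'
  have hm : AEMeasurable (fun q : Y × X => ‖(G ∘ Prod.swap) q‖ₑ ^ 2) (ν.prod μ) :=
    hG'.1.enorm.pow_const 2
  rw [lintegral_prod _ hm] at h
  filter_upwards [ae_lt_top' hm.lintegral_prod_right' h, hG'.1.prodMk_left] with y hy hy'
  exact memLp_two_of_lintegral hy' hy.ne

namespace FibreKernel

variable {C C' C'' : ℝ≥0} {k k' k'' : Y → X → X → ℂ}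

theorem stronglyMeasurable (hk : FibreKernel μ C k) {F : X × Y → ℂ} (hF : StronglyMeasurable F) :
    StronglyMeasurable (fibreIntegral μ k F) := by
  have : StronglyMeasurable fun q : (X × Y) × X => k q.1.2 q.1.1 q.2 * F (q.2, q.1.2) :=
    hk.measurable.stronglyMeasurable.mul (hF.comp_measurable (by fun_prop))
  exact this.integral_prod_right

theorem measurable_lintegral (hk : FibreKernel μ C k) {F : X × Y → ℂ}
    (hF : StronglyMeasurable F) :
    Measurable fun p : X × Y => ∫⁻ w, ‖k p.2 p.1 w‖ₑ * ‖F (w, p.2)‖ₑ ∂μ := by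
  have : Measurable fun q : (X × Y) × X => ‖k q.1.2 q.1.1 q.2‖ₑ * ‖F (q.2, q.1.2)‖ₑ :=
    hk.measurable.enorm.mul (hF.measurable.comp (by fun_prop)).enorm
  exact this.lintegral_prod_right'

theorem lintegral_sq_le (hk : FibreKernel μ C k) {F : X × Y → ℂ} (hF : StronglyMeasurable F) :
    ∫⁻ p, (∫⁻ w, ‖k p.2 p.1 w‖ₑ * ‖F (w, p.2)‖ₑ ∂μ) ^ 2 ∂(μ.prod ν) ≤
      C ^ 2 * ∫⁻ p, ‖F p‖ₑ ^ 2 ∂(μ.prod ν) := by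
  rw [lintegral_prod_symm' _ ((hk.measurable_lintegral hF).pow_const 2),
    lintegral_prod_symm' _ (hF.measurable.enorm.pow_const 2),
    ← lintegral_const_mul' _ _ (by simp)]
  refine lintegral_mono fun y => (hk.schur y).lintegral_sq_le ?_
  exact (hF.measurable.comp measurable_prodMk_right).enorm.aemeasurable

theorem lintegral_sq_fibreIntegral_le (hk : FibreKernel μ C k) {F : X × Y → ℂ}
    (hF : StronglyMeasurable F) :
    ∫⁻ p, ‖fibreIntegral μ k F p‖ₑ ^ 2 ∂(μ.prod ν) ≤ C ^ 2 * ∫⁻ p, ‖F p‖ₑ ^ 2 ∂(μ.prod ν) := by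
  refine le_trans (lintegral_mono fun p => ?_) (hk.lintegral_sq_le hF)
  gcongr
  refine (enorm_integral_le_lintegral_enorm _).trans_eq ?_
  simp [enorm_mul]

theorem memLp (hk : FibreKernel μ C k) {F : X × Y → ℂ} (hF : StronglyMeasurable F)
    (hF2 : MemLp F 2 (μ.prod ν)) : MemLp (fibreIntegral μ k F) 2 (μ.prod ν) := by
  refine memLp_two_of_lintegral (hk.stronglyMeasurable hF).aestronglyMeasurable ?_
  exact ((hk.lintegral_sq_fibreIntegral_le hF).trans_lt (ENNReal.mul_lt_top
    (ENNReal.pow_lt_top ENNReal.coe_lt_top) (lintegral_ne_top_of_memLp_two hF2).lt_top)).ne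

theorem ae_integrable (hk : FibreKernel μ C k) {F : X × Y → ℂ} (hF : StronglyMeasurable F)
    (hF2 : MemLp F 2 (μ.prod ν)) :
    ∀ᵐ p ∂(μ.prod ν), Integrable (fun w => k p.2 p.1 w * F (w, p.2)) μ := by
  have h : ∫⁻ p, (∫⁻ w, ‖k p.2 p.1 w‖ₑ * ‖F (w, p.2)‖ₑ ∂μ) ^ 2 ∂(μ.prod ν) ≠ ∞ :=
    ((hk.lintegral_sq_le hF).trans_lt (ENNReal.mul_lt_top
      (ENNReal.pow_lt_top ENNReal.coe_lt_top) (lintegral_ne_top_of_memLp_two hF2).lt_top)).ne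
  filter_upwards [ae_lt_top ((hk.measurable_lintegral hF).pow_const 2) h] with p hp
  refine ⟨?_, ?_⟩
  · exact (((hk.schur p.2).measurable_left p.1).mul
      (hF.measurable.comp measurable_prodMk_right)).aestronglyMeasurable
  · rw [hasFiniteIntegral_iff_enorm]
    simpa [enorm_mul] using hp

theorem fibreIntegral_ae_congr {F G : X × Y → ℂ} (h : F =ᵐ[μ.prod ν] G) :
    fibreIntegral μ k F =ᵐ[μ.prod ν] fibreIntegral μ k G := by
  filter_upwards [Measure.quasiMeasurePreserving_snd.ae (ae_ae_snd_of_ae_prod h)] with p hp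
  exact fibreIntegral_congr p.2 hp p.1

variable (ν) in
/-- The operator on `L²(X × Y)` that acts in each fibre over `Y` as the integral operator with
kernel `k y`. -/
def op (hk : FibreKernel μ C k) : Lp ℂ 2 (μ.prod ν) →L[ℂ] Lp ℂ 2 (μ.prod ν) :=
  LinearMap.mkContinuous
    { toFun := fun F => (hk.memLp (Lp.stronglyMeasurable F) (Lp.memLp F)).toLp _
      map_add' := fun F G => by
        rw [← MemLp.toLp_add, MemLp.toLp_eq_toLp_iff]
        refine (fibreIntegral_ae_congr (Lp.coeFn_add F G)).trans ?_
        filter_upwards [hk.ae_integrable (Lp.stronglyMeasurable F) (Lp.memLp F),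
          hk.ae_integrable (Lp.stronglyMeasurable G) (Lp.memLp G)] with p h1 h2
        simp only [fibreIntegral, Pi.add_apply, mul_add]
        exact integral_add h1 h2
      map_smul' := fun c F => by
        rw [RingHom.id_apply, ← MemLp.toLp_const_smul, MemLp.toLp_eq_toLp_iff]
        refine (fibreIntegral_ae_congr (Lp.coeFn_smul c F)).trans (.of_forall fun p => ?_)
        simp only [fibreIntegral, Pi.smul_apply, ← integral_smul]
        simp only [smul_eq_mul, mul_left_comm c] }
    C fun F => by
      simp only [LinearMap.coe_mk, AddHom.coe_mk, Lp.norm_def]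
      rw [eLpNorm_congr_ae (hk.memLp (Lp.stronglyMeasurable F) (Lp.memLp F)).coeFn_toLp]
      rw [← ENNReal.coe_toReal, ← ENNReal.toReal_mul]
      refine ENNReal.toReal_mono (ENNReal.mul_ne_top ENNReal.coe_ne_top (Lp.eLpNorm_ne_top _)) ?_
      rw [eLpNorm_two_eq_lintegral, eLpNorm_two_eq_lintegral]
      refine (ENNReal.rpow_le_rpow (hk.lintegral_sq_fibreIntegral_le (ν := ν)
        (Lp.stronglyMeasurable F))
        (by norm_num : (0 : ℝ) ≤ 1 / 2)).trans_eq ?_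
      rw [ENNReal.mul_rpow_of_nonneg _ _ (by norm_num), ← ENNReal.rpow_natCast,
        ← ENNReal.rpow_mul]
      norm_num

theorem coeFn_op (hk : FibreKernel μ C k) (F : Lp ℂ 2 (μ.prod ν)) :
    hk.op ν F =ᵐ[μ.prod ν] fibreIntegral μ k F :=
  (hk.memLp (Lp.stronglyMeasurable F) (Lp.memLp F)).coeFn_toLp

theorem inner_op (hk : FibreKernel μ C k) (F G : Lp ℂ 2 (μ.prod ν)) :
    inner ℂ (hk.op ν F) G = inner ℂ F (hk.adjoint.op ν G) := by
  rw [L2.inner_def, L2.inner_def, integral_prod_symm _ (L2.integrable_inner _ _),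
    integral_prod_symm _ (L2.integrable_inner _ _)]
  refine integral_congr_ae ?_
  filter_upwards [ae_memLp_slice_snd (Lp.memLp F), ae_memLp_slice_snd (Lp.memLp G),
    ae_ae_snd_of_ae_prod (hk.coeFn_op F), ae_ae_snd_of_ae_prod (hk.adjoint.coeFn_op G)]
    with y h1 h2 h3 h4
  have h := (hk.schur y).integral_conj_mul h1 h2
  convert h using 1
  · refine integral_congr_ae ?_
    filter_upwards [h3] with z hz
    rw [RCLike.inner_apply', starRingEnd_apply, hz, fibreIntegral]
  · refine integral_congr_ae ?_
    filter_upwards [h4] with w hw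
    rw [RCLike.inner_apply', starRingEnd_apply, hw, fibreIntegral]

theorem op_op (hk : FibreKernel μ C k) (hk' : FibreKernel μ C' k') (hk'' : FibreKernel μ C'' k'')
    (h : ∀ y z w, ∫ a, k y z a * k' y a w ∂μ = k'' y z w) (F : Lp ℂ 2 (μ.prod ν)) :
    hk.op ν (hk'.op ν F) = hk''.op ν F := by
  refine Lp.ext ?_
  refine (hk.coeFn_op _).trans (EventuallyEq.trans ?_ (hk''.coeFn_op _).symm)
  have hms : MeasurableSet {p : X × Y | fibreIntegral μ k (hk'.op ν F) p =
      fibreIntegral μ k'' F p} :=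
    (hk.stronglyMeasurable (Lp.stronglyMeasurable _)).measurableSet_eq_fun
      (hk''.stronglyMeasurable (Lp.stronglyMeasurable _))
  refine (Measure.ae_prod_iff_ae_ae hms).2 ((Measure.ae_ae_comm hms).2 ?_)
  filter_upwards [ae_memLp_slice_snd (Lp.memLp F), ae_ae_snd_of_ae_prod (hk'.coeFn_op F)]
    with y h1 h2
  filter_upwards [(hk.schur y).ae_integral_integral (hk'.schur y) h1] with z hz
  rw [fibreIntegral_congr y h2]
  simp only [h] at hz
  exact hz

end FibreKernel

end Fibre

/-- If `c T T† T = T`, then `c T† T` is the identity on the orthogonal complement of `ker T`, so that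
`√c T` is isometric there. -/
theorem mul_norm_sq_eq_of_mem_orthogonal_ker {E : Type*} [NormedAddCommGroup E]
    [InnerProductSpace ℂ E] {T T' : E →L[ℂ] E} {c : ℝ}
    (hadj : ∀ x y, inner ℂ (T x) y = inner ℂ x (T' y)) (h : ∀ x, (c : ℂ) • T (T' (T x)) = T x)
    {x : E} (hx : ∀ y, T y = 0 → inner ℂ y x = 0) : c * ‖T x‖ ^ 2 = ‖x‖ ^ 2 := by
  -- `c T†T x - x` lies in `ker T` and is orthogonal to it
  have h1 : T ((c : ℂ) • T' (T x) - x) = 0 := by rw [map_sub, map_smul, h, sub_self]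
  have h2 : inner ℂ ((c : ℂ) • T' (T x) - x) ((c : ℂ) • T' (T x) - x) = 0 := by
    rw [inner_sub_right, inner_smul_right, ← hadj, hx _ h1, h1]
    simp
  have h3 : (c : ℂ) • T' (T x) = x := sub_eq_zero.1 (inner_self_eq_zero.1 h2)
  have h4 : inner ℂ x x = (c : ℂ) * inner ℂ (T x) (T x) := by
    rw [hadj, ← inner_smul_right, h3]
  rw [inner_self_eq_norm_sq_to_K, inner_self_eq_norm_sq_to_K] at h4
  apply Complex.ofReal_injective
  push_cast
  exact h4.symm

/-! ### Gaussian integrals over `ℂ` -/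

theorem integrable_rexp_neg_re_sq_im_sq {a b : ℝ} (ha : 0 < a) (hb : 0 < b) :
    Integrable fun z : ℂ => Real.exp (-(a * z.re ^ 2 + b * z.im ^ 2)) := by
  have h := (integrable_exp_neg_mul_sq ha).mul_prod (integrable_exp_neg_mul_sq hb)
  have h' := Complex.volume_preserving_equiv_real_prod.integrable_comp_of_integrable h
  refine h'.congr (.of_forall fun z => ?_)
  simp [← Real.exp_add]
  ring

theorem integral_rexp_neg_re_sq_im_sq {a b : ℝ} (ha : 0 < a) (hb : 0 < b) :
    ∫ z : ℂ, Real.exp (-(a * z.re ^ 2 + b * z.im ^ 2)) = Real.pi / √(a * b) := by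
  have h := Complex.volume_preserving_equiv_real_prod.integral_comp
    Complex.measurableEquivRealProd.measurableEmbedding
    (fun p : ℝ × ℝ => Real.exp (-a * p.1 ^ 2) * Real.exp (-b * p.2 ^ 2))
  rw [Measure.volume_eq_prod, integral_prod_mul (fun x : ℝ => Real.exp (-a * x ^ 2))
    (fun x : ℝ => Real.exp (-b * x ^ 2)), integral_gaussian, integral_gaussian,
    ← Real.sqrt_mul (by positivity)] at h
  have e : Real.pi / a * (Real.pi / b) = Real.pi ^ 2 / (a * b) := by field_simp
  rw [e, Real.sqrt_div (by positivity), Real.sqrt_sq Real.pi_pos.le] at h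
  rw [← h]
  refine integral_congr_ae (.of_forall fun z => ?_)
  simp [← Real.exp_add]
  ring

/-- The total mass of a translated Gaussian on `ℂ`. -/
theorem lintegral_rexp_neg_sub {a b K : ℝ} (ha : 0 < a) (hb : 0 < b) (hK : 0 ≤ K) (z : ℂ) :
    ∫⁻ w : ℂ, ENNReal.ofReal (K * Real.exp (-(a * (w - z).re ^ 2 + b * (w - z).im ^ 2))) =
      ENNReal.ofReal (K * (Real.pi / √(a * b))) := by
  rw [lintegral_sub_right_eq_self (fun w : ℂ =>
    ENNReal.ofReal (K * Real.exp (-(a * w.re ^ 2 + b * w.im ^ 2)))) z,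
    ← ofReal_integral_eq_lintegral_ofReal ((integrable_rexp_neg_re_sq_im_sq ha hb).const_mul K)
      (.of_forall fun w => by positivity),
    integral_const_mul, integral_rexp_neg_re_sq_im_sq ha hb]

theorem integral_cexp_quadratic_real {a : ℝ} (ha : 0 < a) (c d : ℂ) :
    ∫ x : ℝ, Complex.exp (-(a * x ^ 2) + c * x + d) =
      √(Real.pi / a) * Complex.exp (d + c ^ 2 / (4 * a)) := by
  have h := integral_cexp_quadratic (b := -(a : ℂ)) (by simpa using ha) c d
  simp only [neg_mul] at h
  rw [h, neg_neg, mul_neg, div_neg, sub_neg_eq_add, Real.sqrt_eq_rpow,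
    Complex.ofReal_cpow (by positivity)]
  push_cast
  rfl

/-- The Gaussian integral over `ℂ` of a quadratic exponential whose cross term is imaginary, which
leaves the modulus of the integrand a product of one-dimensional Gaussians. -/
theorem integral_cexp_re_im {a b : ℝ} (ha : 0 < a) (hb : 0 < b) (c : ℝ) (p q : ℂ) :
    ∫ z : ℂ, Complex.exp (-(a * z.re ^ 2) - b * z.im ^ 2 + c * z.re * z.im * Complex.I
        + p * z.re + q * z.im) =
      (Real.pi / √(a * b + c ^ 2 / 4) : ℝ) * Complex.exp (p ^ 2 / (4 * a) +
        (q + c * p / (2 * a) * Complex.I) ^ 2 / (4 * (b + c ^ 2 / (4 * a)))) := by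
  have hb' : 0 < b + c ^ 2 / (4 * a) := by positivity
  have haC : (a : ℂ) ≠ 0 := by exact_mod_cast ha.ne'
  have hbC : (b : ℂ) + c ^ 2 / (4 * a) ≠ 0 := by exact_mod_cast hb'.ne'
  let f : ℝ × ℝ → ℂ := fun t => Complex.exp (-(a * t.1 ^ 2) - b * t.2 ^ 2
    + c * t.1 * t.2 * Complex.I + p * t.1 + q * t.2)
  have hint : Integrable f (volume.prod volume) := by
    have h1 : Integrable fun x : ℝ => Complex.exp (-a * x ^ 2 + p * x + 0) :=
      integrable_cexp_quadratic' (by simpa using ha) _ _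
    have h2 : Integrable fun y : ℝ => Complex.exp (-b * y ^ 2 + q * y + 0) :=
      integrable_cexp_quadratic' (by simpa using hb) _ _
    refine (h1.mul_prod h2).mono (by fun_prop) (.of_forall fun t => ?_)
    simp only [f, Complex.norm_exp, norm_mul, ← Real.exp_add]
    refine (congrArg Real.exp ?_).le
    rw [← Complex.add_re]
    have : (-(a * t.1 ^ 2) - b * t.2 ^ 2 + c * t.1 * t.2 * Complex.I + p * t.1 + q * t.2 : ℂ) =
        (-a * t.1 ^ 2 + p * t.1 + 0 + (-b * t.2 ^ 2 + q * t.2 + 0)) +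
          ((c * t.1 * t.2 : ℝ) : ℂ) * Complex.I := by push_cast; ring
    rw [this, Complex.add_re, Complex.re_ofReal_mul, Complex.I_re, mul_zero, add_zero]
  have h := Complex.volume_preserving_equiv_real_prod.integral_comp
    Complex.measurableEquivRealProd.measurableEmbedding f
  have h1 : ∀ y : ℝ, ∫ x : ℝ, f (x, y) = √(Real.pi / a) *
      Complex.exp (-((b + c ^ 2 / (4 * a) : ℝ) * y ^ 2) + (q + c * p / (2 * a) * Complex.I) * y
        + p ^ 2 / (4 * a)) := by
    intro y
    have e1 : (fun x : ℝ => f (x, y)) = fun x : ℝ => Complex.exp (-(a * x ^ 2) +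
        (c * y * Complex.I + p) * x + (-(b * y ^ 2) + q * y)) := by
      funext x
      simp only [f]
      congr 1
      ring
    rw [e1, integral_cexp_quadratic_real ha]
    congr 2
    push_cast
    field_simp
    ring_nf
    simp only [Complex.I_sq]
    ring
  calc _ = ∫ z : ℂ, f (Complex.measurableEquivRealProd z) := rfl
    _ = ∫ t, f t ∂(volume.prod volume) := h
    _ = ∫ y : ℝ, ∫ x : ℝ, f (x, y) := integral_prod_symm _ hint
    _ = _ := by
      simp only [h1]
      rw [integral_const_mul, integral_cexp_quadratic_real hb', ← mul_assoc, ← Complex.ofReal_mul,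
        ← Real.sqrt_mul (by positivity)]
      have e : Real.pi / a * (Real.pi / (b + c ^ 2 / (4 * a))) =
          Real.pi ^ 2 / (a * b + c ^ 2 / 4) := by field_simp
      rw [e, Real.sqrt_div (by positivity), Real.sqrt_sq Real.pi_pos.le]
      push_cast
      rfl

/-! ### The Leray and Bargmann–Fock exponents -/

/-- The value of `2⟨∂ρ(ζ), ζ - z⟩` at the points `ζ`, `z` of `S_β` whose coordinates
`(x₁ + i y₁, x₂)` are `(w, 0)` and `(z, 0)`. -/
def leviPhase (β : ℝ) (z w : ℂ) : ℂ :=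
  (‖w‖ ^ 2 : ℝ) + (‖z‖ ^ 2 : ℝ) - 2 * conj w * z + 2 * β * w ^ 2 - 2 * β * w * z
    - β * ((w ^ 2).re : ℝ) + β * ((z ^ 2).re : ℝ)

/-- The exponent of the Bargmann–Fock projection, conjugated by the unimodular function
`exp(2πisβ Im z²)`. -/
def fockPhase (β : ℝ) (z b : ℂ) : ℂ :=
  (‖z‖ ^ 2 : ℝ) + (‖b‖ ^ 2 : ℝ) - 2 * z * conj b
    - β * (((z ^ 2).im : ℝ) - ((b ^ 2).im : ℝ)) * Complex.I

theorem norm_mul_self_eq (z : ℂ) : ‖z‖ * ‖z‖ = z.re * z.re + z.im * z.im := by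
  rw [← Complex.normSq_apply, ← Complex.sq_norm, pow_two]

/-- The real part is positive definite in `w - z` because `0 ≤ β < 1`. -/
theorem leviPhase_re (β : ℝ) (z w : ℂ) :
    (leviPhase β z w).re = (1 + β) * (w - z).re ^ 2 + (1 - β) * (w - z).im ^ 2 := by
  simp [leviPhase, norm_mul_self_eq, pow_two, -Complex.ofReal_add,
    -Complex.ofReal_mul]
  ring

theorem fockPhase_re (β : ℝ) (z b : ℂ) :
    (fockPhase β z b).re = 1 * (b - z).re ^ 2 + 1 * (b - z).im ^ 2 := by
  simp [fockPhase, norm_mul_self_eq, pow_two, -Complex.ofReal_add,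
    -Complex.ofReal_mul]
  ring

/-- With `T` the integral operator with kernel `exp(-l Φ)`, the kernel of `T T†` is a multiple of
the Bargmann–Fock kernel: the integrand is a Gaussian in `a`, without a cross term in the
coordinates `Re a`, `Im a`. -/
theorem integral_leviPhase_mul_conj {β : ℝ} (hβ0 : 0 ≤ β) (hβ1 : β < 1) {l : ℝ} (hl : 0 < l)
    (z b : ℂ) :
    ∫ a, Complex.exp (-(l * leviPhase β z a)) * star (Complex.exp (-(l * leviPhase β b a))) =
      (Real.pi / (2 * l * √(1 - β ^ 2)) : ℝ) * Complex.exp (-(l * fockPhase β z b)) := by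
  have hA : 0 < 2 * l * (1 + β) := by positivity
  have hB : 0 < 2 * l * (1 - β) := by have := sub_pos.2 hβ1; positivity
  -- `P`, `Q` and `D` are the coefficients of `Re a`, `Im a` and `1` in the exponent
  set P : ℂ := 2 * l * (1 + β) * (z + conj b) with hP
  set Q : ℂ := -(2 * l * (1 - β) * (z - conj b) * Complex.I) with hQ
  set D : ℂ := -(l * ((‖z‖ ^ 2 : ℝ) + (‖b‖ ^ 2 : ℝ) + β * ((z ^ 2).re : ℝ) + β * ((b ^ 2).re : ℝ)))
    with hD
  have key := integral_cexp_re_im hA hB 0 P Q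
  have e1 : ∀ a : ℂ, Complex.exp (-(l * leviPhase β z a)) *
      star (Complex.exp (-(l * leviPhase β b a))) = Complex.exp D *
      Complex.exp (-((2 * l * (1 + β) : ℝ) * a.re ^ 2) - (2 * l * (1 - β) : ℝ) * a.im ^ 2
        + (0 : ℝ) * a.re * a.im * Complex.I + P * a.re + Q * a.im) := by
    intro a
    rw [← starRingEnd_apply, ← Complex.exp_conj, ← Complex.exp_add, ← Complex.exp_add]
    congr 1
    apply Complex.ext
    · simp [leviPhase, hP, hQ, hD, norm_mul_self_eq, pow_two]
      ring
    · simp [leviPhase, hP, hQ, hD, norm_mul_self_eq, pow_two]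
      ring
  simp only [e1]
  rw [integral_const_mul, key]
  have e2 : √(2 * l * (1 + β) * (2 * l * (1 - β)) + 0 ^ 2 / 4) = 2 * l * √(1 - β ^ 2) := by
    rw [show 2 * l * (1 + β) * (2 * l * (1 - β)) + 0 ^ 2 / 4 = (2 * l) ^ 2 * (1 - β ^ 2) by ring,
      Real.sqrt_mul (by positivity), Real.sqrt_sq (by positivity)]
  rw [e2, mul_left_comm, ← Complex.exp_add]
  congr 2
  have hlC : (l : ℂ) ≠ 0 := by exact_mod_cast hl.ne'
  have h1 : (1 : ℂ) + β ≠ 0 := by exact_mod_cast (by positivity : (1 : ℝ) + β ≠ 0)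
  have h2 : (1 : ℂ) - β ≠ 0 := by exact_mod_cast (sub_pos.2 hβ1).ne'
  have e3 : P ^ 2 / (4 * ((2 * l * (1 + β) : ℝ) : ℂ)) + (Q + (0 : ℝ) * P /
      (2 * ((2 * l * (1 + β) : ℝ) : ℂ)) * Complex.I) ^ 2 / (4 * (((2 * l * (1 - β) : ℝ) : ℂ) +
        ((0 : ℝ) : ℂ) ^ 2 / (4 * ((2 * l * (1 + β) : ℝ) : ℂ)))) =
      l * (β * (z ^ 2 + conj b ^ 2) + 2 * z * conj b) := by
    rw [hP, hQ]
    push_cast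
    simp only [zero_mul, zero_div, ne_eq, OfNat.ofNat_ne_zero, not_false_eq_true, zero_pow,
      add_zero]
    rw [neg_sq, mul_pow _ Complex.I, Complex.I_sq]
    field_simp
    ring
  rw [e3, hD]
  apply Complex.ext
  · simp [fockPhase, pow_two, -Complex.ofReal_add, -Complex.ofReal_mul]
    ring
  · simp [fockPhase, pow_two, -Complex.ofReal_add, -Complex.ofReal_mul]
    ring

/-- The reproducing property of the Bargmann–Fock kernel on the range of the Leray transform: up to
the twist and a Gaussian weight, `exp(-l Φ(z, w))` is holomorphic in `z`. -/
theorem integral_fockPhase_mul_leviPhase {β : ℝ} (hβ0 : 0 ≤ β) (hβ1 : β < 1) {l : ℝ} (hl : 0 < l)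
    (z w : ℂ) :
    ∫ b, Complex.exp (-(l * fockPhase β z b)) * Complex.exp (-(l * leviPhase β b w)) =
      (Real.pi / (2 * l) : ℝ) * Complex.exp (-(l * leviPhase β z w)) := by
  have hA : 0 < l * (2 + β) := by positivity
  have hB : 0 < l * (2 - β) := by have : 0 < 2 - β := by linarith
                                  positivity
  set m : ℂ := conj w + β * w with hm
  -- `P`, `Q` and `D` are the coefficients of `Re b`, `Im b` and `1` in the exponent
  set P : ℂ := 2 * l * (z + m) with hP
  set Q : ℂ := 2 * l * (m - z) * Complex.I with hQ
  set D : ℂ := -(l * ((‖z‖ ^ 2 : ℝ) - β * ((z ^ 2).im : ℝ) * Complex.I + (‖w‖ ^ 2 : ℝ) +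
    2 * β * w ^ 2 - β * ((w ^ 2).re : ℝ))) with hD
  have key := integral_cexp_re_im hA hB (-(2 * l * β)) P Q
  have e1 : ∀ b : ℂ, Complex.exp (-(l * fockPhase β z b)) *
      Complex.exp (-(l * leviPhase β b w)) = Complex.exp D *
      Complex.exp (-((l * (2 + β) : ℝ) * b.re ^ 2) - (l * (2 - β) : ℝ) * b.im ^ 2
        + (-(2 * l * β) : ℝ) * b.re * b.im * Complex.I + P * b.re + Q * b.im) := by
    intro a
    rw [← Complex.exp_add, ← Complex.exp_add]
    congr 1
    apply Complex.ext
    · simp [leviPhase, fockPhase, hP, hQ, hD, hm, norm_mul_self_eq, pow_two]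
      ring
    · simp [leviPhase, fockPhase, hP, hQ, hD, hm, norm_mul_self_eq, pow_two]
      ring
  simp only [e1]
  rw [integral_const_mul, key]
  have e2 : √(l * (2 + β) * (l * (2 - β)) + (-(2 * l * β)) ^ 2 / 4) = 2 * l := by
    rw [show l * (2 + β) * (l * (2 - β)) + (-(2 * l * β)) ^ 2 / 4 = (2 * l) ^ 2 by ring,
      Real.sqrt_sq (by positivity)]
  rw [e2, mul_left_comm, ← Complex.exp_add]
  congr 2
  have hlC : (l : ℂ) ≠ 0 := by exact_mod_cast hl.ne'
  have h1 : (2 : ℂ) + β ≠ 0 := by exact_mod_cast (by positivity : (2 : ℝ) + β ≠ 0)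
  have e4 : ((l * (2 - β) : ℝ) : ℂ) + ((-(2 * l * β) : ℝ) : ℂ) ^ 2 /
      (4 * ((l * (2 + β) : ℝ) : ℂ)) = 4 * l / (2 + β) := by
    push_cast
    field_simp
    ring
  have e3 : P ^ 2 / (4 * ((l * (2 + β) : ℝ) : ℂ)) + (Q + ((-(2 * l * β) : ℝ) : ℂ) * P /
      (2 * ((l * (2 + β) : ℝ) : ℂ)) * Complex.I) ^ 2 / (4 * (((l * (2 - β) : ℝ) : ℂ) +
        ((-(2 * l * β) : ℝ) : ℂ) ^ 2 / (4 * ((l * (2 + β) : ℝ) : ℂ)))) =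
      l * (2 * m * z - β * z ^ 2) := by
    rw [e4, hQ, ← add_mul, mul_pow _ Complex.I, Complex.I_sq, hP]
    push_cast
    field_simp
    ring
  rw [e3, hD, hm]
  apply Complex.ext
  · simp [leviPhase, pow_two, -Complex.ofReal_add, -Complex.ofReal_mul]
    ring
  · simp [leviPhase, pow_two, -Complex.ofReal_add, -Complex.ofReal_mul]
    ring

/-! ### The Leray transform at a fixed frequency -/

theorem schurKernel_of_gaussian {κ : ℂ → ℂ → ℂ} (hκ : Measurable (Function.uncurry κ))
    {a b K C : ℝ} (ha : 0 < a) (hb : 0 < b) (hK : 0 ≤ K)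
    (h : ∀ z w, ‖κ z w‖ = K * Real.exp (-(a * (w - z).re ^ 2 + b * (w - z).im ^ 2)))
    (hC : K * (Real.pi / √(a * b)) = C) : SchurKernel volume C.toNNReal κ where
  measurable := hκ
  left z := by
    simp only [← ofReal_norm, h, lintegral_rexp_neg_sub ha hb hK, hC]
    exact le_rfl
  right w := by
    have h' : ∀ z, ‖κ z w‖ = K * Real.exp (-(a * (z - w).re ^ 2 + b * (z - w).im ^ 2)) := by
      intro z
      rw [h, ← neg_sub z w, Complex.neg_re, Complex.neg_im, neg_sq, neg_sq]
    simp only [← ofReal_norm, h', lintegral_rexp_neg_sub ha hb hK, hC]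
    exact le_rfl

theorem SchurKernel.zero : SchurKernel (volume : Measure ℂ) 0 (fun _ _ => 0) where
  measurable := measurable_const
  left := by simp
  right := by simp

theorem SchurKernel.mono {X : Type*} [MeasurableSpace X] {μ : Measure X} {C C' : ℝ≥0}
    {κ : X → X → ℂ} (h : SchurKernel μ C κ) (hC : C ≤ C') : SchurKernel μ C' κ where
  measurable := h.measurable
  left z := (h.left z).trans (by exact_mod_cast hC)
  right w := (h.right w).trans (by exact_mod_cast hC)

/-- The kernel of the Leray transform at the frequency `s`. It vanishes for `s ≤ 0`, since the Leray
kernel is a Laplace integral over positive frequencies. -/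
def lerayKernel (β s : ℝ) (z w : ℂ) : ℂ :=
  if 0 < s then (4 * s : ℝ) * Complex.exp (-((2 * Real.pi * s : ℝ) * leviPhase β z w)) else 0

/-- The (twisted) Bargmann–Fock kernel at the frequency `s`, divided by `√(1 - β²)`. -/
def fockKernel (β s : ℝ) (z w : ℂ) : ℂ :=
  if 0 < s then (4 * s / √(1 - β ^ 2) : ℝ) *
    Complex.exp (-((2 * Real.pi * s : ℝ) * fockPhase β z w)) else 0

theorem norm_mul_cexp_neg_mul {K l : ℝ} (hK : 0 ≤ K) (u : ℂ) :
    ‖(K : ℂ) * Complex.exp (-(l * u))‖ = K * Real.exp (-(l * u.re)) := by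
  rw [norm_mul, Complex.norm_exp, Complex.norm_real, Real.norm_of_nonneg hK, Complex.neg_re,
    Complex.re_ofReal_mul]

theorem norm_lerayKernel {β s : ℝ} (hs : 0 < s) (z w : ℂ) :
    ‖lerayKernel β s z w‖ = 4 * s * Real.exp (-(2 * Real.pi * s * (1 + β) * (w - z).re ^ 2 +
      2 * Real.pi * s * (1 - β) * (w - z).im ^ 2)) := by
  rw [lerayKernel, if_pos hs, norm_mul_cexp_neg_mul (by positivity), leviPhase_re]
  ring_nf

theorem continuous_leviPhase (β : ℝ) : Continuous (Function.uncurry (leviPhase β)) := by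
  unfold leviPhase Function.uncurry
  fun_prop

theorem continuous_fockPhase (β : ℝ) : Continuous (Function.uncurry (fockPhase β)) := by
  unfold fockPhase Function.uncurry
  fun_prop

theorem measurable_lerayKernel (β : ℝ) :
    Measurable fun q : ℝ × ℂ × ℂ => lerayKernel β q.1 q.2.1 q.2.2 := by
  refine Measurable.ite (measurableSet_lt measurable_const measurable_fst) ?_ measurable_const
  have : Measurable fun q : ℝ × ℂ × ℂ => leviPhase β q.2.1 q.2.2 :=
    (continuous_leviPhase β).measurable.comp measurable_snd
  fun_prop

theorem measurable_fockKernel (β : ℝ) :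
    Measurable fun q : ℝ × ℂ × ℂ => fockKernel β q.1 q.2.1 q.2.2 := by
  refine Measurable.ite (measurableSet_lt measurable_const measurable_fst) ?_ measurable_const
  have : Measurable fun q : ℝ × ℂ × ℂ => fockPhase β q.2.1 q.2.2 :=
    (continuous_fockPhase β).measurable.comp measurable_snd
  fun_prop

theorem sqrt_one_sub_sq_pos {β : ℝ} (hβ0 : 0 ≤ β) (hβ1 : β < 1) : 0 < √(1 - β ^ 2) :=
  Real.sqrt_pos.2 (by nlinarith)

theorem fibreKernel_lerayKernel {β : ℝ} (hβ0 : 0 ≤ β) (hβ1 : β < 1) :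
    FibreKernel volume (2 / √(1 - β ^ 2)).toNNReal (lerayKernel β) where
  measurable := (measurable_lerayKernel β).comp
    (by fun_prop : Measurable fun q : (ℂ × ℝ) × ℂ => (q.1.2, q.1.1, q.2))
  schur s := by
    by_cases hs : 0 < s
    · have hβ := sub_pos.2 hβ1
      refine schurKernel_of_gaussian ?_ (a := 2 * Real.pi * s * (1 + β))
        (b := 2 * Real.pi * s * (1 - β)) (K := 4 * s) (by positivity) (by positivity)
        (by positivity) (norm_lerayKernel hs) ?_
      · exact (measurable_lerayKernel β).comp (measurable_prodMk_left (x := s))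
      · rw [show 2 * Real.pi * s * (1 + β) * (2 * Real.pi * s * (1 - β)) =
          (2 * Real.pi * s) ^ 2 * (1 - β ^ 2) by ring, Real.sqrt_mul (by positivity),
          Real.sqrt_sq (by positivity)]
        have := sqrt_one_sub_sq_pos hβ0 hβ1
        field_simp
        norm_num
    · have : lerayKernel β s = fun _ _ => 0 := by
        funext z w
        rw [lerayKernel, if_neg hs]
      rw [this]
      exact SchurKernel.zero.mono zero_le

theorem fibreKernel_fockKernel {β : ℝ} (hβ0 : 0 ≤ β) (hβ1 : β < 1) :
    FibreKernel volume (2 / √(1 - β ^ 2)).toNNReal (fockKernel β) where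
  measurable := (measurable_fockKernel β).comp
    (by fun_prop : Measurable fun q : (ℂ × ℝ) × ℂ => (q.1.2, q.1.1, q.2))
  schur s := by
    by_cases hs : 0 < s
    · have hβ := sqrt_one_sub_sq_pos hβ0 hβ1
      refine schurKernel_of_gaussian ?_ (a := 2 * Real.pi * s)
        (b := 2 * Real.pi * s) (K := 4 * s / √(1 - β ^ 2)) (by positivity) (by positivity)
        (by positivity) (fun z w => ?_) ?_
      · exact (measurable_fockKernel β).comp (measurable_prodMk_left (x := s))
      · rw [fockKernel, if_pos hs, norm_mul_cexp_neg_mul (by positivity), fockPhase_re]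
        ring_nf
      · rw [Real.sqrt_mul_self (by positivity)]
        field_simp
        norm_num
    · have : fockKernel β s = fun _ _ => 0 := by
        funext z w
        rw [fockKernel, if_neg hs]
      rw [this]
      exact SchurKernel.zero.mono zero_le

theorem FibreKernel.const_mul {X Y : Type*} [MeasurableSpace X] [MeasurableSpace Y]
    {μ : Measure X} {C : ℝ≥0} {k : Y → X → X → ℂ} (hk : FibreKernel μ C k) (c : ℂ) :
    FibreKernel μ (‖c‖₊ * C) (fun y z w => c * k y z w) where
  measurable := hk.measurable.const_mul c
  schur y :=
    { measurable := (hk.schur y).measurable.const_mul c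
      left := fun z => by
        simp only [enorm_mul, ENNReal.coe_mul]
        rw [lintegral_const_mul' _ _ enorm_ne_top]
        exact mul_le_mul_right ((hk.schur y).left z) _
      right := fun w => by
        simp only [enorm_mul, ENNReal.coe_mul]
        rw [lintegral_const_mul' _ _ enorm_ne_top]
        exact mul_le_mul_right ((hk.schur y).right w) _ }

theorem FibreKernel.const_mul_op {X Y : Type*} [MeasurableSpace X] [MeasurableSpace Y]
    {μ : Measure X} {ν : Measure Y} [SFinite μ] [SFinite ν] {C : ℝ≥0} {k : Y → X → X → ℂ}
    (hk : FibreKernel μ C k) (c : ℂ) (F : Lp ℂ 2 (μ.prod ν)) :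
    (hk.const_mul c).op ν F = c • hk.op ν F := by
  refine Lp.ext (((hk.const_mul c).coeFn_op F).trans ?_)
  filter_upwards [hk.coeFn_op F, Lp.coeFn_smul c (hk.op ν F)] with p h1 h2
  rw [h2, Pi.smul_apply, h1]
  simp only [fibreIntegral, mul_assoc, integral_const_mul, smul_eq_mul]

/-- The Leray transform after the partial Fourier transform in `x₂`. -/
def lerayFourierOp {β : ℝ} (hβ0 : 0 ≤ β) (hβ1 : β < 1) :
    Lp ℂ 2 ((volume : Measure ℂ).prod (volume : Measure ℝ)) →L[ℂ]
      Lp ℂ 2 ((volume : Measure ℂ).prod (volume : Measure ℝ)) :=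
  (fibreKernel_lerayKernel hβ0 hβ1).op volume

theorem lerayKernel_comp_adjoint {β : ℝ} (hβ0 : 0 ≤ β) (hβ1 : β < 1) (s : ℝ) (z b : ℂ) :
    ∫ a, lerayKernel β s z a * star (lerayKernel β s b a) = fockKernel β s z b := by
  by_cases hs : 0 < s
  · have h := integral_leviPhase_mul_conj hβ0 hβ1 (l := 2 * Real.pi * s) (by positivity) z b
    have hc := sqrt_one_sub_sq_pos hβ0 hβ1
    simp only [lerayKernel, fockKernel, if_pos hs]
    calc _ = ∫ a, ((4 * s) ^ 2 : ℝ) *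
          (Complex.exp (-((2 * Real.pi * s : ℝ) * leviPhase β z a)) *
            star (Complex.exp (-((2 * Real.pi * s : ℝ) * leviPhase β b a)))) := by
          refine integral_congr_ae (.of_forall fun a => ?_)
          simp only [← starRingEnd_apply, map_mul, Complex.conj_ofReal]
          push_cast
          ring
      _ = _ := by
          rw [integral_const_mul, h, ← mul_assoc, ← Complex.ofReal_mul]
          congr 2
          field_simp
          norm_num
  · simp [lerayKernel, fockKernel, if_neg hs]

theorem fockKernel_comp_lerayKernel {β : ℝ} (hβ0 : 0 ≤ β) (hβ1 : β < 1) (s : ℝ) (z w : ℂ) :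
    ∫ b, fockKernel β s z b * lerayKernel β s b w =
      ((√(1 - β ^ 2))⁻¹ : ℝ) * lerayKernel β s z w := by
  by_cases hs : 0 < s
  · have h := integral_fockPhase_mul_leviPhase hβ0 hβ1 (l := 2 * Real.pi * s) (by positivity) z w
    have hc := sqrt_one_sub_sq_pos hβ0 hβ1
    simp only [lerayKernel, fockKernel, if_pos hs]
    calc _ = ∫ b, (4 * s / √(1 - β ^ 2) * (4 * s) : ℝ) *
          (Complex.exp (-((2 * Real.pi * s : ℝ) * fockPhase β z b)) *
            Complex.exp (-((2 * Real.pi * s : ℝ) * leviPhase β b w))) := by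
          refine integral_congr_ae (.of_forall fun a => ?_)
          push_cast
          ring
      _ = _ := by
          rw [integral_const_mul, h]
          simp only [← mul_assoc, ← Complex.ofReal_mul]
          congr 2
          field_simp
          norm_num
  · simp [lerayKernel, fockKernel, if_neg hs]

/-- `√(1 - β²) T T† T = T` for the Leray transform `T` on the Fourier side. -/
theorem lerayFourierOp_adjoint_lerayFourierOp {β : ℝ} (hβ0 : 0 ≤ β) (hβ1 : β < 1)
    (F : Lp ℂ 2 ((volume : Measure ℂ).prod (volume : Measure ℝ))) :
    (√(1 - β ^ 2) : ℂ) • lerayFourierOp hβ0 hβ1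
      ((fibreKernel_lerayKernel hβ0 hβ1).adjoint.op volume (lerayFourierOp hβ0 hβ1 F)) =
        lerayFourierOp hβ0 hβ1 F := by
  have hk := fibreKernel_lerayKernel hβ0 hβ1
  have hp := fibreKernel_fockKernel hβ0 hβ1
  have h1 : lerayFourierOp hβ0 hβ1 (hk.adjoint.op volume (lerayFourierOp hβ0 hβ1 F)) =
      hp.op volume (lerayFourierOp hβ0 hβ1 F) :=
    hk.op_op hk.adjoint hp (lerayKernel_comp_adjoint hβ0 hβ1) _
  have h2 : hp.op volume (lerayFourierOp hβ0 hβ1 F) =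
      (hk.const_mul ((√(1 - β ^ 2))⁻¹ : ℝ)).op volume F :=
    hp.op_op hk (hk.const_mul _) (fockKernel_comp_lerayKernel hβ0 hβ1) F
  have hc : (√(1 - β ^ 2) : ℂ) ≠ 0 := by exact_mod_cast (sqrt_one_sub_sq_pos hβ0 hβ1).ne'
  rw [h1, h2, hk.const_mul_op, Complex.ofReal_inv, smul_inv_smul₀ hc]
  rfl

theorem norm_sq_lerayFourierOp {β : ℝ} (hβ0 : 0 ≤ β) (hβ1 : β < 1)
    {F : Lp ℂ 2 ((volume : Measure ℂ).prod (volume : Measure ℝ))}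
    (hF : ∀ G, lerayFourierOp hβ0 hβ1 G = 0 → inner ℂ G F = 0) :
    √(1 - β ^ 2) * ‖lerayFourierOp hβ0 hβ1 F‖ ^ 2 = ‖F‖ ^ 2 :=
  mul_norm_sq_eq_of_mem_orthogonal_ker (fibreKernel_lerayKernel hβ0 hβ1).inner_op
    (lerayFourierOp_adjoint_lerayFourierOp hβ0 hβ1) hF

/-! ### The Leray kernel as a Fourier integral -/

/-- The Leray kernel of `S_β` in the coordinates `(x₁ + i y₁, x₂)`, at the point of `Ω_β` that lies
`ε` above the point of `S_β` with coordinates `p`. -/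
def modelKernel (β ε : ℝ) (p q : ℂ × ℝ) : ℂ :=
  1 / (Real.pi : ℂ) ^ 2 / (leviPhase β p.1 q.1 + ε + (q.2 - p.2) * Complex.I) ^ 2

/-- The function of `(w, s)` whose partial Fourier transform is the Leray kernel. -/
def modelSymbol (β ε : ℝ) (p q : ℂ × ℝ) : ℂ :=
  lerayKernel β q.2 p.1 q.1 * Complex.exp (-((2 * Real.pi * q.2 : ℝ) * (ε - p.2 * Complex.I)))

theorem integrableOn_mul_rexp_neg {r : ℝ} (hr : 0 < r) :
    IntegrableOn (fun s : ℝ => s * Real.exp (-(r * s))) (Set.Ioi 0) := by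
  have h := integrableOn_rpow_mul_exp_neg_mul_rpow (s := 1) (p := 1) (by norm_num) (by norm_num) hr
  simpa using h

theorem integral_Ioi_mul_cexp_neg {r : ℂ} (hr : 0 < r.re) :
    ∫ s : ℝ in Set.Ioi 0, (s : ℂ) * Complex.exp (-(r * s)) = 1 / r ^ 2 := by
  have hr0 : r ≠ 0 := by rintro rfl; simp at hr
  have hd : ∀ s ∈ Set.Ici (0 : ℝ), HasDerivAt
      (fun s : ℝ => -(((s : ℂ) / r + 1 / r ^ 2) * Complex.exp (-(r * s))))
      ((s : ℂ) * Complex.exp (-(r * s))) s := by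
    intro s _
    have h1 : HasDerivAt (fun s : ℝ => (s : ℂ)) 1 s := Complex.ofRealCLM.hasDerivAt
    have h2 := ((h1.div_const r).add_const (1 / r ^ 2)).mul (h1.const_mul r).neg.cexp
    refine HasDerivAt.congr_deriv h2.neg ?_
    simp only [Pi.neg_apply]
    field_simp
    ring
  have hi : IntegrableOn (fun s : ℝ => (s : ℂ) * Complex.exp (-(r * s))) (Set.Ioi 0) := by
    refine (integrableOn_mul_rexp_neg hr).mono' (by fun_prop) ?_
    refine (ae_restrict_mem measurableSet_Ioi).mono fun s hs => le_of_eq ?_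
    rw [norm_mul, Complex.norm_exp, Complex.norm_real, Real.norm_of_nonneg (le_of_lt hs)]
    simp
  have ht : Tendsto (fun s : ℝ => -(((s : ℂ) / r + 1 / r ^ 2) * Complex.exp (-(r * s)))) atTop
      (𝓝 0) := by
    have h1 : Tendsto (fun s : ℝ => (s : ℂ) * Complex.exp (-(r * s))) atTop (𝓝 0) := by
      refine squeeze_zero_norm' ?_ (tendsto_rpow_mul_exp_neg_mul_atTop_nhds_zero 1 r.re hr)
      filter_upwards [eventually_ge_atTop 0] with s hs
      rw [norm_mul, Complex.norm_exp, Complex.norm_real, Real.norm_of_nonneg hs]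
      simp
    have h2 : Tendsto (fun s : ℝ => Complex.exp (-(r * s))) atTop (𝓝 0) := by
      refine squeeze_zero_norm' ?_ (tendsto_rpow_mul_exp_neg_mul_atTop_nhds_zero 0 r.re hr)
      filter_upwards with s
      rw [Complex.norm_exp]
      simp
    have h3 := ((h1.div_const r).add (h2.const_mul (1 / r ^ 2))).neg
    simp only [zero_div, mul_zero, add_zero, neg_zero] at h3
    refine h3.congr fun s => ?_
    ring
  rw [integral_Ioi_of_hasDerivAt_of_tendsto' hd hi ht]
  simp

theorem modelSymbol_eq_indicator (β ε : ℝ) (p q : ℂ × ℝ) :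
    modelSymbol β ε p q = (Set.Ioi 0).indicator (fun s : ℝ => 4 * (s * Complex.exp
      (-(2 * Real.pi * (leviPhase β p.1 q.1 + ε - p.2 * Complex.I) * s)))) q.2 := by
  by_cases hs : 0 < q.2
  · rw [Set.indicator_of_mem (Set.mem_Ioi.2 hs), modelSymbol, lerayKernel, if_pos hs, mul_assoc,
      ← Complex.exp_add]
    push_cast
    ring_nf
  · rw [Set.indicator_of_notMem (by simpa using hs), modelSymbol, lerayKernel, if_neg hs, zero_mul]

theorem leviPhase_re_nonneg {β : ℝ} (hβ0 : 0 ≤ β) (hβ1 : β < 1) (z w : ℂ) :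
    0 ≤ (leviPhase β z w).re := by
  have := sub_pos.2 hβ1
  rw [leviPhase_re]
  positivity

theorem measurable_modelSymbol (β ε : ℝ) (p : ℂ × ℝ) : Measurable (modelSymbol β ε p) := by
  refine Measurable.mul ?_ (by fun_prop)
  exact (measurable_lerayKernel β).comp
    (by fun_prop : Measurable fun q : ℂ × ℝ => (q.2, p.1, q.1))

theorem integrable_modelSymbol_slice {β : ℝ} (hβ0 : 0 ≤ β) (hβ1 : β < 1) {ε : ℝ} (hε : 0 < ε)
    (p : ℂ × ℝ) (w : ℂ) : Integrable fun s => modelSymbol β ε p (w, s) := by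
  simp only [modelSymbol_eq_indicator]
  have h0 := leviPhase_re_nonneg hβ0 hβ1 p.1 w
  have hr : 0 < 2 * Real.pi * ((leviPhase β p.1 w).re + ε) := by positivity
  rw [integrable_indicator_iff measurableSet_Ioi]
  refine ((integrableOn_mul_rexp_neg hr).const_mul 4).mono' (by fun_prop) ?_
  refine (ae_restrict_mem measurableSet_Ioi).mono fun s hs => le_of_eq ?_
  rw [norm_mul, norm_mul, Complex.norm_exp, Complex.norm_real,
    Real.norm_of_nonneg (le_of_lt hs)]
  simp

theorem partialFourier_modelSymbol {β : ℝ} (hβ0 : 0 ≤ β) (hβ1 : β < 1) {ε : ℝ} (hε : 0 < ε)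
    (p q : ℂ × ℝ) : partialFourier 1 (modelSymbol β ε p) q = modelKernel β ε p q := by
  have h0 := leviPhase_re_nonneg hβ0 hβ1 p.1 q.1
  set r : ℂ := 2 * Real.pi * (leviPhase β p.1 q.1 + ε + (q.2 - p.2) * Complex.I) with hr
  have hr0 : 0 < r.re := by
    have : r.re = 2 * Real.pi * ((leviPhase β p.1 q.1).re + ε) := by simp [hr]
    rw [this]
    positivity
  have hpi : (Real.pi : ℂ) ≠ 0 := by exact_mod_cast Real.pi_ne_zero
  rw [partialFourier, one_mul, Real.fourier_eq']
  simp only [modelSymbol_eq_indicator, smul_eq_mul]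
  calc _ = ∫ s : ℝ, (Set.Ioi 0).indicator (fun s : ℝ =>
        4 * ((s : ℂ) * Complex.exp (-(r * s)))) s := by
        refine integral_congr_ae (.of_forall fun s => ?_)
        simp only
        by_cases hs : s ∈ Set.Ioi (0 : ℝ)
        · rw [Set.indicator_of_mem hs, Set.indicator_of_mem hs, mul_left_comm,
            mul_left_comm _ (s : ℂ), ← Complex.exp_add]
          simp [hr]
          ring_nf
          simp
        · rw [Set.indicator_of_notMem hs, Set.indicator_of_notMem hs, mul_zero]
    _ = 4 * (1 / r ^ 2) := by
        rw [integral_indicator measurableSet_Ioi, integral_const_mul,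
          integral_Ioi_mul_cexp_neg hr0]
    _ = _ := by
        have : leviPhase β p.1 q.1 + ε + (q.2 - p.2) * Complex.I ≠ 0 := by
          rintro h
          rw [hr, h] at hr0
          simp at hr0
        rw [modelKernel, hr]
        field_simp
        norm_num

/-- Integrating the Gaussian in `w` first leaves a multiple of `s e^{-4πεs}`. -/
theorem memLp_modelSymbol {β : ℝ} (hβ0 : 0 ≤ β) (hβ1 : β < 1) {ε : ℝ} (hε : 0 < ε) (p : ℂ × ℝ) :
    MemLp (modelSymbol β ε p) 2 ((volume : Measure ℂ).prod (volume : Measure ℝ)) := by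
  have hm := measurable_modelSymbol β ε p
  refine memLp_two_of_lintegral hm.aestronglyMeasurable ?_
  rw [lintegral_prod_symm' _ (hm.enorm.pow_const 2)]
  have hc := sqrt_one_sub_sq_pos hβ0 hβ1
  have hβ := sub_pos.2 hβ1
  have key : ∀ s, ∫⁻ w, ‖modelSymbol β ε p (w, s)‖ₑ ^ 2 = (Set.Ioi 0).indicator (fun s : ℝ =>
      ENNReal.ofReal (4 / √(1 - β ^ 2) * (s * Real.exp (-(4 * Real.pi * ε * s))))) s := by
    intro s
    by_cases hs : 0 < s
    · rw [Set.indicator_of_mem (Set.mem_Ioi.2 hs)]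
      have h := lintegral_rexp_neg_sub (a := 4 * Real.pi * s * (1 + β))
        (b := 4 * Real.pi * s * (1 - β)) (K := 16 * s ^ 2 * Real.exp (-(4 * Real.pi * ε * s)))
        (by positivity) (by positivity) (by positivity) p.1
      rw [show 4 * Real.pi * s * (1 + β) * (4 * Real.pi * s * (1 - β)) =
          (4 * Real.pi * s) ^ 2 * (1 - β ^ 2) by ring, Real.sqrt_mul (by positivity),
          Real.sqrt_sq (by positivity)] at h
      have e : 16 * s ^ 2 * Real.exp (-(4 * Real.pi * ε * s)) *
          (Real.pi / (4 * Real.pi * s * √(1 - β ^ 2))) =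
          4 / √(1 - β ^ 2) * (s * Real.exp (-(4 * Real.pi * ε * s))) := by
        field_simp
        norm_num
      rw [← e, ← h]
      refine lintegral_congr fun w => ?_
      rw [← ofReal_norm, ← ENNReal.ofReal_pow (norm_nonneg _)]
      congr 1
      rw [modelSymbol, norm_mul, norm_lerayKernel hs, Complex.norm_exp, mul_pow, mul_pow,
        ← Real.exp_nat_mul, ← Real.exp_nat_mul, mul_pow, mul_assoc (16 * s ^ 2), ← Real.exp_add,
        mul_assoc _ (Real.exp _), ← Real.exp_add]
      simp
      ring_nf
    · rw [Set.indicator_of_notMem (by simpa using hs)]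
      simp [modelSymbol, lerayKernel, if_neg hs]
  simp only [key]
  rw [lintegral_indicator measurableSet_Ioi]
  have hi := (integrableOn_mul_rexp_neg (r := 4 * Real.pi * ε) (by positivity)).const_mul
    (4 / √(1 - β ^ 2))
  have h2 := hi.2
  rw [hasFiniteIntegral_iff_enorm] at h2
  refine (lt_of_eq_of_lt (setLIntegral_congr_fun measurableSet_Ioi fun s hs => ?_) h2).ne
  have : (0 : ℝ) < s := hs
  rw [Real.enorm_of_nonneg (by positivity)]

/-! ### The Leray transform in coordinates -/

theorem partialFourier_neg_star {X : Type*} {σ : ℝ} (G : X × ℝ → ℂ) (p : X × ℝ) :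
    partialFourier (-σ) (fun q => star (G q)) p = star (partialFourier σ G p) := by
  simp only [partialFourier, Real.fourier_eq', smul_eq_mul, ← starRingEnd_apply, ← integral_conj]
  refine integral_congr_ae (.of_forall fun s => ?_)
  simp [← Complex.exp_conj, Complex.conj_ofNat]

/-- The measure `dx₁ dy₁ dx₂` on the parameter space `ℂ × ℝ` of `S_β`. -/
abbrev paramVolume : Measure (ℂ × ℝ) := (volume : Measure ℂ).prod (volume : Measure ℝ)

theorem memLp_modelKernel {β : ℝ} (hβ0 : 0 ≤ β) (hβ1 : β < 1) {ε : ℝ} (hε : 0 < ε)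
    (p : ℂ × ℝ) : MemLp (modelKernel β ε p) 2 paramVolume := by
  have h : MemLp (partialFourier 1 (modelSymbol β ε p)) 2 paramVolume := by
    have hm := memLp_modelSymbol hβ0 hβ1 hε p
    have h1 := partialFourierL2_toLp (σ := 1) (by simp) hm
      (.of_forall (integrable_modelSymbol_slice hβ0 hβ1 hε p))
    exact (memLp_congr_ae h1).1 (Lp.memLp _)
  exact (funext (partialFourier_modelSymbol hβ0 hβ1 hε p)) ▸ h

/-- The Leray integral on the Fourier side. The pairing is bilinear, so the sesquilinear unitarity of
the partial Fourier transform is applied to the complex conjugate of the kernel. -/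
theorem integral_mul_modelKernel {β : ℝ} (hβ0 : 0 ≤ β) (hβ1 : β < 1) {ε : ℝ} (hε : 0 < ε)
    (p : ℂ × ℝ) (f : Lp ℂ 2 paramVolume) :
    ∫ q, f q * modelKernel β ε p q ∂paramVolume =
      ∫ q, modelSymbol β ε p q * partialFourierEquiv volume f q ∂paramVolume := by
  have hK := (memLp_modelKernel hβ0 hβ1 hε p).star
  have hk := (memLp_modelSymbol hβ0 hβ1 hε p).star
  have h1 : partialFourierL2 (σ := -1) (by simp) (hk.toLp _) = hK.toLp _ := by
    refine Lp.ext ((partialFourierL2_toLp (σ := -1) (by simp) hk (.of_forall fun w =>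
      memLp_one_iff_integrable.1 (memLp_one_iff_integrable.2
        (integrable_modelSymbol_slice hβ0 hβ1 hε p w)).star)).trans
        (EventuallyEq.trans (.of_forall fun q => ?_) hK.coeFn_toLp.symm))
    have h := partialFourier_neg_star (σ := 1) (modelSymbol β ε p) q
    rw [partialFourier_modelSymbol hβ0 hβ1 hε] at h
    exact h
  have h2 : inner ℂ (hK.toLp _) f = inner ℂ (hk.toLp _) (partialFourierEquiv volume f) := by
    rw [← h1, inner_partialFourierL2 (by simp) (by simp)]
    simp only [neg_neg]
    rfl
  rw [L2.inner_def, L2.inner_def] at h2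
  convert h2 using 1
  · refine integral_congr_ae ?_
    filter_upwards [hK.coeFn_toLp] with q hq
    rw [hq, RCLike.inner_apply', Pi.star_apply, starRingEnd_apply, star_star, mul_comm]
  · refine integral_congr_ae ?_
    filter_upwards [hk.coeFn_toLp] with q hq
    rw [hq, RCLike.inner_apply', Pi.star_apply, starRingEnd_apply, star_star]

/-- The Leray integral at height `ε` on the Fourier side, before the inverse partial Fourier
transform: the factor `e^{-2πεs}` for `s > 0`, with `s` replaced by `max s 0` so that it stays
bounded, times the fibre integral. -/
def dampedFibreIntegral (β ε : ℝ) (F : ℂ × ℝ → ℂ) (p : ℂ × ℝ) : ℂ :=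
  Real.exp (-(2 * Real.pi * ε * max p.2 0)) * fibreIntegral volume (lerayKernel β) F p

theorem integral_modelSymbol_mul (β ε : ℝ) (F : ℂ × ℝ → ℂ) (p : ℂ × ℝ) (s : ℝ) :
    ∫ w, modelSymbol β ε p (w, s) * F (w, s) =
      Complex.exp (2 * Real.pi * (s * p.2) * Complex.I) * dampedFibreIntegral β ε F (p.1, s) := by
  simp only [modelSymbol, dampedFibreIntegral, fibreIntegral, ← integral_const_mul]
  refine integral_congr_ae (.of_forall fun w => ?_)
  by_cases hs : 0 < s
  · simp only [max_eq_left hs.le, Complex.ofReal_exp]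
    have : Complex.exp (-((2 * Real.pi * s : ℝ) * (ε - p.2 * Complex.I))) =
        Complex.exp (2 * Real.pi * (s * p.2) * Complex.I) *
          Complex.exp ((-(2 * Real.pi * ε * s) : ℝ)) := by
      rw [← Complex.exp_add]
      push_cast
      ring_nf
    rw [this]
    ring
  · simp [lerayKernel, if_neg hs]

theorem integrable_modelSymbol_mul {β : ℝ} (hβ0 : 0 ≤ β) (hβ1 : β < 1) {ε : ℝ} (hε : 0 < ε)
    (p : ℂ × ℝ) (F : Lp ℂ 2 paramVolume) :
    Integrable (fun q => modelSymbol β ε p q * F q) paramVolume :=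
  (memLp_modelSymbol hβ0 hβ1 hε p).integrable_mul (Lp.memLp F)

theorem integrable_dampedFibreIntegral_slice {β : ℝ} (hβ0 : 0 ≤ β) (hβ1 : β < 1) {ε : ℝ}
    (hε : 0 < ε) (F : Lp ℂ 2 paramVolume) (z : ℂ) :
    Integrable fun s => dampedFibreIntegral β ε F (z, s) := by
  have h := (integrable_modelSymbol_mul hβ0 hβ1 hε (z, 0) F).integral_prod_right
  refine h.congr (.of_forall fun s => ?_)
  simp only [integral_modelSymbol_mul]
  simp

/-- The Leray integral at height `ε` is the inverse partial Fourier transform of the damped fibre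
integral, pointwise and not only almost everywhere. -/
theorem integral_mul_modelKernel_eq_partialFourier {β : ℝ} (hβ0 : 0 ≤ β) (hβ1 : β < 1) {ε : ℝ}
    (hε : 0 < ε) (p : ℂ × ℝ) (f : Lp ℂ 2 paramVolume) :
    ∫ q, f q * modelKernel β ε p q ∂paramVolume =
      partialFourier (-1) (dampedFibreIntegral β ε (partialFourierEquiv volume f)) p := by
  rw [integral_mul_modelKernel hβ0 hβ1 hε,
    integral_prod_symm _ (integrable_modelSymbol_mul hβ0 hβ1 hε p _), partialFourier,
    Real.fourier_eq']
  refine integral_congr_ae (.of_forall fun s => ?_)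
  simp only [integral_modelSymbol_mul]
  simp
  ring_nf
  simp

theorem stronglyMeasurable_dampedFibreIntegral {β : ℝ} (hβ0 : 0 ≤ β) (hβ1 : β < 1) (ε : ℝ)
    (F : Lp ℂ 2 paramVolume) : StronglyMeasurable (dampedFibreIntegral β ε F) := by
  have h := (fibreKernel_lerayKernel hβ0 hβ1).stronglyMeasurable (Lp.stronglyMeasurable F)
  have h1 : Continuous fun p : ℂ × ℝ => (Real.exp (-(2 * Real.pi * ε * max p.2 0)) : ℂ) := by
    fun_prop
  exact h1.stronglyMeasurable.mul h

theorem norm_exp_neg_max_le_one {ε : ℝ} (hε : 0 < ε) (s : ℝ) :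
    Real.exp (-(2 * Real.pi * ε * max s 0)) ≤ 1 :=
  Real.exp_le_one_iff.2 (neg_nonpos.2 (by positivity))

theorem memLp_dampedFibreIntegral {β : ℝ} (hβ0 : 0 ≤ β) (hβ1 : β < 1) {ε : ℝ} (hε : 0 < ε)
    (F : Lp ℂ 2 paramVolume) : MemLp (dampedFibreIntegral β ε F) 2 paramVolume := by
  refine ((fibreKernel_lerayKernel hβ0 hβ1).memLp (Lp.stronglyMeasurable F) (Lp.memLp F)).mono
    (stronglyMeasurable_dampedFibreIntegral hβ0 hβ1 ε F).aestronglyMeasurable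
    (.of_forall fun p => ?_)
  rw [dampedFibreIntegral, norm_mul, Complex.norm_real, Real.norm_of_nonneg (Real.exp_pos _).le]
  exact mul_le_of_le_one_left (norm_nonneg _) (norm_exp_neg_max_le_one hε _)

theorem tendsto_dampedFibreIntegral {β : ℝ} (hβ0 : 0 ≤ β) (hβ1 : β < 1)
    (F : Lp ℂ 2 paramVolume) :
    Tendsto (fun ε : ℝ => eLpNorm (dampedFibreIntegral β ε F -
      fibreIntegral volume (lerayKernel β) F) 2 paramVolume) (𝓝[>] 0) (𝓝 0) := by
  have hk := fibreKernel_lerayKernel hβ0 hβ1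
  have hm := hk.stronglyMeasurable (Lp.stronglyMeasurable F)
  have hL := hk.memLp (Lp.stronglyMeasurable F) (Lp.memLp F)
  simp only [eLpNorm_two_eq_lintegral]
  have h : Tendsto (fun ε : ℝ => ∫⁻ p, ‖(dampedFibreIntegral β ε F -
      fibreIntegral volume (lerayKernel β) F) p‖ₑ ^ 2 ∂paramVolume) (𝓝[>] 0)
      (𝓝 (∫⁻ _, 0 ∂paramVolume)) := by
    refine tendsto_lintegral_filter_of_dominated_convergence
      (fun p => ‖fibreIntegral volume (lerayKernel β) F p‖ₑ ^ 2) (.of_forall fun ε => ?_) ?_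
      (lintegral_ne_top_of_memLp_two hL) (.of_forall fun p => ?_)
    · exact ((stronglyMeasurable_dampedFibreIntegral hβ0 hβ1 ε F).sub hm).enorm.pow_const 2
    · filter_upwards [self_mem_nhdsWithin] with ε hε
      refine .of_forall fun p => ?_
      gcongr
      rw [Pi.sub_apply, dampedFibreIntegral, ← sub_one_mul, enorm_mul]
      refine mul_le_of_le_one_left' ?_
      have h1 := norm_exp_neg_max_le_one hε p.2
      have h2 := Real.exp_pos (-(2 * Real.pi * ε * max p.2 0))
      rw [← Complex.ofReal_one, ← Complex.ofReal_sub, ← ofReal_norm, Complex.norm_real]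
      refine ENNReal.ofReal_le_one.2 (abs_le.2 ⟨?_, ?_⟩) <;> linarith
    · have hc : Continuous fun ε : ℝ => ‖(dampedFibreIntegral β ε F -
          fibreIntegral volume (lerayKernel β) F) p‖ₑ ^ 2 := by
        simp only [Pi.sub_apply, dampedFibreIntegral]
        refine (ENNReal.continuous_pow 2).comp (continuous_enorm.comp ?_)
        fun_prop
      have := (hc.tendsto 0).mono_left (nhdsWithin_le_nhds (s := Set.Ioi 0))
      simpa [dampedFibreIntegral] using this
  rw [lintegral_zero] at h
  have := h.ennrpow_const (1 / 2)
  simpa using this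

/-- The Leray transform in the coordinates `(x₁ + i y₁, x₂)`. -/
def modelTransform {β : ℝ} (hβ0 : 0 ≤ β) (hβ1 : β < 1) :
    Lp ℂ 2 paramVolume →L[ℂ] Lp ℂ 2 paramVolume :=
  (partialFourierEquiv volume).symm.toContinuousLinearEquiv.toContinuousLinearMap ∘L
    lerayFourierOp hβ0 hβ1 ∘L
      (partialFourierEquiv volume).toContinuousLinearEquiv.toContinuousLinearMap

theorem modelTransform_apply {β : ℝ} (hβ0 : 0 ≤ β) (hβ1 : β < 1) (f : Lp ℂ 2 paramVolume) :
    modelTransform hβ0 hβ1 f =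
      (partialFourierEquiv volume).symm (lerayFourierOp hβ0 hβ1 (partialFourierEquiv volume f)) :=
  rfl

theorem tendsto_integral_mul_modelKernel {β : ℝ} (hβ0 : 0 ≤ β) (hβ1 : β < 1)
    (f : Lp ℂ 2 paramVolume) :
    Tendsto (fun ε : ℝ => eLpNorm (fun p => (∫ q, f q * modelKernel β ε p q ∂paramVolume) -
      modelTransform hβ0 hβ1 f p) 2 paramVolume) (𝓝[>] 0) (𝓝 0) := by
  set F := partialFourierEquiv volume f with hF
  refine (tendsto_dampedFibreIntegral hβ0 hβ1 F).congr' ?_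
  filter_upwards [self_mem_nhdsWithin] with ε hε
  have hG := memLp_dampedFibreIntegral hβ0 hβ1 hε F
  have hk := fibreKernel_lerayKernel hβ0 hβ1
  have h1 := partialFourierL2_toLp (σ := -1) (by simp) hG
    (.of_forall (integrable_dampedFibreIntegral_slice hβ0 hβ1 hε F))
  have h2 : (fun p => (∫ q, f q * modelKernel β ε p q ∂paramVolume) - modelTransform hβ0 hβ1 f p)
      =ᵐ[paramVolume] (partialFourierEquiv volume).symm (hG.toLp _ - lerayFourierOp hβ0 hβ1 F) := by
    rw [map_sub, ← modelTransform_apply]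
    filter_upwards [h1, Lp.coeFn_sub ((partialFourierEquiv volume).symm (hG.toLp _))
      (modelTransform hβ0 hβ1 f)] with p hp hp'
    rw [hp', Pi.sub_apply, integral_mul_modelKernel_eq_partialFourier hβ0 hβ1 hε, ← hp]
    rfl
  have h3 : (dampedFibreIntegral β ε F - fibreIntegral volume (lerayKernel β) F)
      =ᵐ[paramVolume] (hG.toLp _ - lerayFourierOp hβ0 hβ1 F : Lp ℂ 2 paramVolume) := by
    filter_upwards [hG.coeFn_toLp, Lp.coeFn_sub (hG.toLp _) (lerayFourierOp hβ0 hβ1 F),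
      hk.coeFn_op F] with p h1 h2 h3
    rw [h2, Pi.sub_apply, Pi.sub_apply, h1, lerayFourierOp, h3]
  rw [eLpNorm_congr_ae h2, eLpNorm_congr_ae h3, ← Lp.enorm_def, ← Lp.enorm_def]
  exact ((partialFourierEquiv volume).symm.enorm_map _).symm

theorem norm_sq_modelTransform {β : ℝ} (hβ0 : 0 ≤ β) (hβ1 : β < 1) {f : Lp ℂ 2 paramVolume}
    (hf : ∀ g, modelTransform hβ0 hβ1 g = 0 → inner ℂ g f = 0) :
    √(1 - β ^ 2) * ‖modelTransform hβ0 hβ1 f‖ ^ 2 = ‖f‖ ^ 2 := by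
  rw [modelTransform_apply, LinearIsometryEquiv.norm_map, norm_sq_lerayFourierOp,
    LinearIsometryEquiv.norm_map]
  intro G hG
  have h := hf ((partialFourierEquiv volume).symm G) (by
    rw [modelTransform_apply, LinearIsometryEquiv.apply_symm_apply, hG, map_zero])
  rwa [← LinearIsometryEquiv.inner_map_map (partialFourierEquiv volume),
    LinearIsometryEquiv.apply_symm_apply] at h

/-! ### The Leray kernel of `S_β` in coordinates -/

theorem rho_eq (β : ℝ) (ζ : C2) :
    rho β ζ = (1 + β) * (ζ 0).re ^ 2 + (1 - β) * (ζ 0).im ^ 2 - (ζ 1).im := by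
  simp [rho, norm_mul_self_eq, pow_two]
  ring

theorem fderiv_rho (β : ℝ) (ζ v : C2) :
    fderiv ℝ (fun η => (rho β η : ℂ)) ζ v =
      ((2 * (1 + β) * (ζ 0).re * (v 0).re + 2 * (1 - β) * (ζ 0).im * (v 0).im - (v 1).im : ℝ) : ℂ)
    := by
  have hp : ∀ j, HasFDerivAt (fun η : C2 => η j) (ContinuousLinearMap.proj (R := ℝ) j) ζ :=
    fun j => hasFDerivAt_apply j ζ
  have hre := Complex.reCLM.hasFDerivAt.comp ζ (hp 0)
  have him := Complex.imCLM.hasFDerivAt.comp ζ (hp 0)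
  have him1 := Complex.imCLM.hasFDerivAt.comp ζ (hp 1)
  have h := Complex.ofRealCLM.hasFDerivAt.comp ζ
    ((((hre.pow 2).const_mul (1 + β)).add ((him.pow 2).const_mul (1 - β))).sub him1)
  have h' := h.congr_of_eventuallyEq (f₁ := fun η : C2 => (rho β η : ℂ))
    (.of_forall fun η => by simp [rho_eq])
  rw [h'.fderiv]
  simp
  ring

theorem wirt_zero_rho (β : ℝ) (ζ : C2) :
    wirt 0 (fun η => (rho β η : ℂ)) ζ = conj (ζ 0) + β * ζ 0 := by
  rw [wirt, fderiv_rho, fderiv_rho]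
  apply Complex.ext <;> simp <;> ring

theorem wirt_one_rho (β : ℝ) (ζ : C2) :
    wirt 1 (fun η => (rho β η : ℂ)) ζ = Complex.I / 2 := by
  rw [wirt, fderiv_rho, fderiv_rho]
  simp

theorem del_rho (β : ℝ) (ζ v : C2) :
    del (rho β) ζ v = (conj (ζ 0) + β * ζ 0) * v 0 + Complex.I / 2 * v 1 := by
  rw [del, Fin.sum_univ_two, wirt_zero_rho, wirt_one_rho]

theorem fderiv_wirt_zero_rho (β : ℝ) (ζ v : C2) :
    fderiv ℝ (fun η : C2 => conj (η 0) + β * η 0) ζ v = conj (v 0) + β * v 0 := by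
  have hp : HasFDerivAt (fun η : C2 => η 0) (ContinuousLinearMap.proj (R := ℝ) 0) ζ :=
    hasFDerivAt_apply 0 ζ
  have h := (Complex.conjCLE.toContinuousLinearMap.hasFDerivAt.comp ζ hp).add
    (hp.const_mul (β : ℂ))
  have h' := h.fderiv
  have e : (fun η : C2 => conj (η 0) + β * η 0) =
      (Complex.conjCLE.toContinuousLinearMap ∘ fun η : C2 => η 0) + fun η : C2 => β * η 0 := by
    funext η
    simp
  rw [e, h']
  simp

theorem delBarDel_rho (β : ℝ) (ζ u v : C2) :
    delBarDel (rho β) ζ u v = star (u 0) * v 0 - star (v 0) * u 0 := by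
  have h0 : wirt 0 (fun η => (rho β η : ℂ)) = fun ζ : C2 => conj (ζ 0) + β * ζ 0 :=
    funext (wirt_zero_rho β)
  have h1 : wirt 1 (fun η => (rho β η : ℂ)) = fun _ => Complex.I / 2 := funext (wirt_one_rho β)
  have h00 : wirtBar 0 (fun ζ : C2 => conj (ζ 0) + β * ζ 0) ζ = 1 := by
    rw [wirtBar, fderiv_wirt_zero_rho, fderiv_wirt_zero_rho]
    apply Complex.ext <;> simp
  have h01 : wirtBar 1 (fun ζ : C2 => conj (ζ 0) + β * ζ 0) ζ = 0 := by
    rw [wirtBar, fderiv_wirt_zero_rho, fderiv_wirt_zero_rho]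
    simp
  have h1k : ∀ k, wirtBar k (fun _ : C2 => Complex.I / 2) ζ = 0 := by
    intro k
    simp [wirtBar]
  simp only [delBarDel, Fin.sum_univ_two, h0, h1, h00, h01, h1k]
  ring

theorem differentiableAt_graph_height (β : ℝ) (w : ℂ) :
    DifferentiableAt ℝ (fun w : ℂ => ‖w‖ ^ 2 + β * (w ^ 2).re) w := by
  have e : (fun w : ℂ => ‖w‖ ^ 2 + β * (w ^ 2).re) =
      fun w : ℂ => (1 + β) * w.re ^ 2 + (1 - β) * w.im ^ 2 := by
    funext w
    simp [norm_mul_self_eq, pow_two]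
    ring
  rw [e]
  have h1 : DifferentiableAt ℝ (fun w : ℂ => w.re) w := Complex.reCLM.differentiableAt
  have h2 : DifferentiableAt ℝ (fun w : ℂ => w.im) w := Complex.imCLM.differentiableAt
  fun_prop

/-- The components of the tangent vectors of `S_β`. Only the first one and the summand `a.2` of the
second enter the Leray kernel, so the differential of `|ζ₁|² + β Re ζ₁²` is left unevaluated. -/
theorem tangent_eq (β : ℝ) (ζ : C2) (a : ℂ × ℝ) :
    tangent β ζ a = ![a.1, (a.2 : ℂ) +
      (fderiv ℝ (fun w : ℂ => ‖w‖ ^ 2 + β * (w ^ 2).re) (ζ 0) a.1 : ℂ) * Complex.I] := by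
  have hfst : HasFDerivAt (fun p : ℂ × ℝ => p.1) (ContinuousLinearMap.fst ℝ ℂ ℝ)
    (ζ 0, (ζ 1).re) := hasFDerivAt_fst
  have hsnd : HasFDerivAt (fun p : ℂ × ℝ => p.2) (ContinuousLinearMap.snd ℝ ℂ ℝ)
    (ζ 0, (ζ 1).re) := hasFDerivAt_snd
  have hh := (differentiableAt_graph_height β (ζ 0)).hasFDerivAt
  have h1 := (Complex.ofRealCLM.hasFDerivAt.comp _ hsnd).add
    ((Complex.ofRealCLM.hasFDerivAt.comp _ (hh.comp (ζ 0, (ζ 1).re) hfst)).mul_const Complex.I)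
  obtain ⟨L, hL, hLa⟩ : ∃ L : ℂ × ℝ →L[ℝ] ℂ, HasFDerivAt (fun p => graph β p 1) L (ζ 0, (ζ 1).re) ∧
      L a = (a.2 : ℂ) +
        (fderiv ℝ (fun w : ℂ => ‖w‖ ^ 2 + β * (w ^ 2).re) (ζ 0) a.1 : ℂ) * Complex.I :=
    ⟨_, h1, by simp [mul_comm]⟩
  have hg : HasFDerivAt (graph β) (ContinuousLinearMap.pi ![ContinuousLinearMap.fst ℝ ℂ ℝ, L])
      (ζ 0, (ζ 1).re) := by
    refine hasFDerivAt_pi.2 fun j => ?_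
    fin_cases j
    · exact hfst
    · exact hL
  rw [tangent, hg.fderiv]
  funext j
  fin_cases j
  · rfl
  · exact hLa

/-- On `S_β` the form `∂ρ ∧ ∂̄∂ρ` is `-dx₁ ∧ dy₁ ∧ dx₂`. -/
theorem delWedge_tangent (β : ℝ) (ζ : C2) :
    delWedge (rho β) ζ (tangent β ζ (1, 0)) (tangent β ζ (Complex.I, 0)) (tangent β ζ (0, 1)) =
      -1 := by
  simp only [delWedge, delBarDel_rho, del_rho, tangent_eq]
  simp
  ring_nf
  simp

theorem two_mul_del_rho (β ε : ℝ) (p q : ℂ × ℝ) :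
    2 * del (rho β) (graph β q) (graph β q - (graph β p + ![0, (ε : ℂ) * Complex.I])) =
      leviPhase β p.1 q.1 + ε + (q.2 - p.2) * Complex.I := by
  rw [del_rho]
  apply Complex.ext
  · simp [graph, leviPhase, norm_mul_self_eq, pow_two]
    ring
  · simp [graph, leviPhase, norm_mul_self_eq, pow_two]
    ring

/-- The Leray kernel of `S_β` in coordinates. -/
theorem ell_graph (β ε : ℝ) (p q : ℂ × ℝ) :
    ell β (graph β p + ![0, (ε : ℂ) * Complex.I]) (graph β q) = modelKernel β ε p q := by
  rw [ell, lerayForm, delWedge_tangent, modelKernel, ← two_mul_del_rho]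
  have hpi : (Real.pi : ℂ) ≠ 0 := by exact_mod_cast Real.pi_ne_zero
  -- for `ε ≤ 0` the denominator may vanish; both sides are then `0` by convention
  set D := del (rho β) (graph β q) (graph β q - (graph β p + ![0, (ε : ℂ) * Complex.I]))
  by_cases hD : D = 0
  · simp [hD]
  · rw [mul_pow _ Complex.I, Complex.I_sq]
    field_simp

/-! ### Transfer to `L²(S_β, σ)` -/

/-- The parametrization of `S_β` by `ℂ × ℝ`, as a measurable equivalence. -/
def paramEquiv (β : ℝ) : ℂ × ℝ ≃ᵐ S β where
  toFun p := ⟨graph β p, graph_mem β p⟩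
  invFun ζ := ((ζ : C2) 0, ((ζ : C2) 1).re)
  left_inv p := by simp [graph, -Complex.ofReal_add, -Complex.ofReal_mul]
  right_inv ζ := by
    have hζ : ((ζ : C2) 1).im = ‖(ζ : C2) 0‖ ^ 2 + β * (((ζ : C2) 0) ^ 2).re := ζ.2
    refine Subtype.ext (funext fun j => ?_)
    fin_cases j
    · simp [graph]
    · apply Complex.ext
      · simp [graph, -Complex.ofReal_add, -Complex.ofReal_mul]
      · simp [graph, -Complex.ofReal_add, -Complex.ofReal_mul, hζ]
  measurable_toFun := by
    refine Measurable.subtype_mk (measurable_pi_lambda _ fun j => ?_)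
    fin_cases j
    · exact measurable_fst
    · change Measurable fun p : ℂ × ℝ =>
        (p.2 : ℂ) + ((‖p.1‖ ^ 2 + β * (p.1 ^ 2).re : ℝ) : ℂ) * Complex.I
      fun_prop
  measurable_invFun := by
    have h : ∀ j, Measurable fun ζ : S β => (ζ : C2) j := fun j =>
      (measurable_pi_apply j).comp measurable_subtype_coe
    exact (h 0).prodMk (Complex.measurable_re.comp (h 1))

theorem measurePreserving_paramEquiv (β : ℝ) :
    MeasurePreserving (paramEquiv β) paramVolume (sigma β) :=
  ⟨(paramEquiv β).measurable, rfl⟩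

theorem coe_paramEquiv (β : ℝ) (p : ℂ × ℝ) : (paramEquiv β p : C2) = graph β p := rfl

theorem measurePreserving_paramEquiv_symm (β : ℝ) :
    MeasurePreserving (paramEquiv β).symm (sigma β) paramVolume :=
  (measurePreserving_paramEquiv β).symm _

/-- The pullback of functions on `S_β` to the parameter space, as a unitary operator. -/
def paramPullback (β : ℝ) : L2S β ≃ₗᵢ[ℂ] Lp ℂ 2 paramVolume :=
  LinearIsometryEquiv.ofSurjective
    (Lp.compMeasurePreservingₗᵢ ℂ (paramEquiv β) (measurePreserving_paramEquiv β)) fun g => by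
      refine ⟨Lp.compMeasurePreserving (paramEquiv β).symm
        (measurePreserving_paramEquiv_symm β) g, ?_⟩
      change Lp.compMeasurePreserving _ _ (Lp.compMeasurePreserving _ _ g) = g
      rw [← Lp.compMeasurePreserving_comp_apply]
      simp only [MeasurableEquiv.symm_comp_self]
      exact Lp.compMeasurePreserving_id_apply g

theorem coeFn_paramPullback (β : ℝ) (f : L2S β) :
    paramPullback β f =ᵐ[paramVolume] f ∘ paramEquiv β :=
  Lp.coeFn_compMeasurePreserving f (measurePreserving_paramEquiv β)

theorem eLpNorm_sigma (β : ℝ) (g : S β → ℂ) :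
    eLpNorm g 2 (sigma β) = eLpNorm (g ∘ paramEquiv β) 2 paramVolume :=
  (paramEquiv β).measurableEmbedding.eLpNorm_map_measure

theorem lerayIntegral_graph_add (β ε : ℝ) (f : L2S β) (p : ℂ × ℝ) :
    lerayIntegral β f (graph β p + ![0, (ε : ℂ) * Complex.I]) =
      ∫ q, paramPullback β f q * modelKernel β ε p q ∂paramVolume := by
  rw [lerayIntegral, ← (measurePreserving_paramEquiv β).integral_comp
    (paramEquiv β).measurableEmbedding]
  refine integral_congr_ae ?_
  filter_upwards [coeFn_paramPullback β f] with q hq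
  rw [hq, coe_paramEquiv, ell_graph, Function.comp_apply]

theorem exists_eq_graph_add_of_mem_Omega {β : ℝ} {z : C2} (hz : z ∈ Omega β) :
    ∃ p : ℂ × ℝ, ∃ ε : ℝ, 0 < ε ∧ z = graph β p + ![0, (ε : ℂ) * Complex.I] := by
  replace hz : (z 1).im > ‖z 0‖ ^ 2 + β * ((z 0) ^ 2).re := hz
  refine ⟨(z 0, (z 1).re), _, sub_pos.2 hz, funext fun j => ?_⟩
  fin_cases j
  · simp [graph]
  · apply Complex.ext
    · simp [graph, -Complex.ofReal_add, -Complex.ofReal_mul, -Complex.ofReal_sub]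
    · simp [graph, -Complex.ofReal_add, -Complex.ofReal_mul, -Complex.ofReal_sub]

theorem integrable_mul_ell {β : ℝ} (hβ0 : 0 ≤ β) (hβ1 : β < 1) (f : L2S β) {z : C2}
    (hz : z ∈ Omega β) : Integrable (fun ζ : S β => f ζ * ell β z ζ) (sigma β) := by
  obtain ⟨p, ε, hε, rfl⟩ := exists_eq_graph_add_of_mem_Omega hz
  rw [← (measurePreserving_paramEquiv β).integrable_comp_emb (paramEquiv β).measurableEmbedding]
  have h : Integrable (fun q => paramPullback β f q * modelKernel β ε p q) paramVolume :=
    (Lp.memLp _).integrable_mul (memLp_modelKernel hβ0 hβ1 hε p)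
  refine h.congr ?_
  filter_upwards [coeFn_paramPullback β f] with q hq
  rw [hq, Function.comp_apply, Function.comp_apply, coe_paramEquiv, ell_graph]

/-- The operator of the Leray transform on `L²(S_β, σ)`, as a conjugate of `modelTransform`. -/
def surfaceTransform {β : ℝ} (hβ0 : 0 ≤ β) (hβ1 : β < 1) : L2S β →L[ℂ] L2S β :=
  (paramPullback β).symm.toContinuousLinearEquiv.toContinuousLinearMap ∘L
    modelTransform hβ0 hβ1 ∘L (paramPullback β).toContinuousLinearEquiv.toContinuousLinearMap

theorem paramPullback_surfaceTransform {β : ℝ} (hβ0 : 0 ≤ β) (hβ1 : β < 1) (f : L2S β) :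
    paramPullback β (surfaceTransform hβ0 hβ1 f) = modelTransform hβ0 hβ1 (paramPullback β f) :=
  (paramPullback β).apply_symm_apply _

theorem isLerayTransform_surfaceTransform {β : ℝ} (hβ0 : 0 ≤ β) (hβ1 : β < 1) :
    IsLerayTransform β (surfaceTransform hβ0 hβ1) := by
  refine fun f => ⟨fun z hz => integrable_mul_ell hβ0 hβ1 f hz, ?_⟩
  refine (tendsto_integral_mul_modelKernel hβ0 hβ1 (paramPullback β f)).congr fun ε => ?_
  rw [eLpNorm_sigma]
  refine eLpNorm_congr_ae ?_
  filter_upwards [coeFn_paramPullback β (surfaceTransform hβ0 hβ1 f)] with p hp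
  rw [← paramPullback_surfaceTransform, hp, Function.comp_apply, Function.comp_apply,
    coe_paramEquiv, lerayIntegral_graph_add]

theorem aestronglyMeasurable_lerayIntegral {β : ℝ} (hβ0 : 0 ≤ β) (hβ1 : β < 1) {ε : ℝ}
    (hε : 0 < ε) (f : L2S β) : AEStronglyMeasurable
      (fun z : S β => lerayIntegral β f ((z : C2) + ![0, (ε : ℂ) * Complex.I])) (sigma β) := by
  refine ((paramEquiv β).measurableEmbedding.aestronglyMeasurable_map_iff).2 ?_
  have h : ∀ p, lerayIntegral β f (graph β p + ![0, (ε : ℂ) * Complex.I]) = _ := fun p =>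
    (lerayIntegral_graph_add β ε f p).trans
      (integral_mul_modelKernel_eq_partialFourier hβ0 hβ1 hε p (paramPullback β f))
  refine AEStronglyMeasurable.congr (StronglyMeasurable.aestronglyMeasurable
    (stronglyMeasurable_partialFourier (-1) (stronglyMeasurable_dampedFibreIntegral hβ0 hβ1 ε
      (partialFourierEquiv volume (paramPullback β f))))) (.of_forall fun p => (h p).symm)

/-- Boundary values in `L²` are unique, so the operator chosen in the definition of
`lerayTransform` is the one constructed here. -/
theorem IsLerayTransform.unique {β : ℝ} (hβ0 : 0 ≤ β) (hβ1 : β < 1) {L L' : L2S β →L[ℂ] L2S β}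
    (h : IsLerayTransform β L) (h' : IsLerayTransform β L') : L = L' := by
  refine ContinuousLinearMap.ext fun f => ?_
  have hlim := (h f).2.add (h' f).2
  rw [add_zero] at hlim
  have hle : eLpNorm (fun z => L f z - L' f z) 2 (sigma β) ≤ 0 := by
    refine ge_of_tendsto hlim ?_
    filter_upwards [self_mem_nhdsWithin] with ε hε
    have hm := aestronglyMeasurable_lerayIntegral hβ0 hβ1 hε f
    have h1 := eLpNorm_sub_le (μ := sigma β) (p := 2) (hm.sub (Lp.aestronglyMeasurable (L' f)))
      (hm.sub (Lp.aestronglyMeasurable (L f))) (by norm_num)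
    rw [add_comm]
    refine le_trans (le_of_eq (congrArg (fun g => eLpNorm g 2 (sigma β)) ?_)) h1
    funext z
    simp
  have h0 := (eLpNorm_eq_zero_iff ((Lp.aestronglyMeasurable (L f)).sub
    (Lp.aestronglyMeasurable (L' f))) (by norm_num)).1 (le_antisymm hle zero_le)
  refine Lp.ext ?_
  filter_upwards [h0] with z hz
  exact sub_eq_zero.1 hz

theorem isLerayTransform_lerayTransform {β : ℝ} (hβ0 : 0 ≤ β) (hβ1 : β < 1) :
    IsLerayTransform β (lerayTransform β) := by
  have h : ∃ L : L2S β →L[ℂ] L2S β, IsLerayTransform β L :=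
    ⟨_, isLerayTransform_surfaceTransform hβ0 hβ1⟩
  rw [lerayTransform, dif_pos h]
  exact h.choose_spec

theorem norm_sq_lerayTransform {β : ℝ} (hβ0 : 0 ≤ β) (hβ1 : β < 1) (f : W β) :
    √(1 - β ^ 2) * ‖lerayTransform β f‖ ^ 2 = ‖f‖ ^ 2 := by
  have hL := (isLerayTransform_lerayTransform hβ0 hβ1).unique hβ0 hβ1
    (isLerayTransform_surfaceTransform hβ0 hβ1)
  have hf : ∀ y, surfaceTransform hβ0 hβ1 y = 0 → inner ℂ y (f : L2S β) = 0 := fun y hy =>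
    f.2 y (by rw [LinearMap.mem_ker, hL]; exact hy)
  rw [hL, ← LinearIsometryEquiv.norm_map (paramPullback β), paramPullback_surfaceTransform,
    norm_sq_modelTransform, LinearIsometryEquiv.norm_map, Submodule.coe_norm]
  intro g hg
  have h := hf ((paramPullback β).symm g) (by
    rw [← (paramPullback β).map_eq_zero_iff, paramPullback_surfaceTransform,
      LinearIsometryEquiv.apply_symm_apply, hg])
  rwa [← LinearIsometryEquiv.inner_map_map (paramPullback β),
    LinearIsometryEquiv.apply_symm_apply] at h

end LerayModel

end

theorem theoremT (β : ℝ) (hβ0 : 0 ≤ β) (hβ1 : β < 1) :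
    LerayModel.IsLerayTransform β (LerayModel.lerayTransform β) ∧
    Isometry (fun f : LerayModel.W β =>
      (((1 - β ^ 2) ^ (1 / 4 : ℝ) : ℝ) : ℂ) • LerayModel.Q β f) ∧
    Function.Surjective (fun f : LerayModel.W β =>
      (((1 - β ^ 2) ^ (1 / 4 : ℝ) : ℝ) : ℂ) • LerayModel.Q β f) := by
  have hpos : 0 < 1 - β ^ 2 := by nlinarith
  set a : ℝ := (1 - β ^ 2) ^ (1 / 4 : ℝ) with ha
  have ha0 : 0 < a := Real.rpow_pos_of_pos hpos _
  have ha2 : a ^ 2 = √(1 - β ^ 2) := by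
    rw [ha, ← Real.rpow_natCast, ← Real.rpow_mul hpos.le, Real.sqrt_eq_rpow]
    norm_num
  refine ⟨LerayModel.isLerayTransform_lerayTransform hβ0 hβ1, ?_, ?_⟩
  · refine Isometry.of_dist_eq fun f g => ?_
    rw [dist_eq_norm, dist_eq_norm, ← smul_sub, ← map_sub, norm_smul, Complex.norm_real,
      Real.norm_of_nonneg ha0.le]
    refine (pow_left_inj₀ (by positivity) (norm_nonneg _) two_ne_zero).1 ?_
    rw [mul_pow, ha2]
    exact LerayModel.norm_sq_lerayTransform hβ0 hβ1 (f - g)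
  · rintro ⟨_, g, rfl⟩
    have : CompleteSpace (LinearMap.ker
        (LerayModel.lerayTransform β : LerayModel.L2S β →ₗ[ℂ] LerayModel.L2S β)) :=
      (LerayModel.lerayTransform β).completeSpace_ker
    -- the component of `g` in `ker L` does not contribute to `L g`
    obtain ⟨k, hk, f, hf, hg⟩ := Submodule.exists_add_mem_mem_orthogonal (K := LinearMap.ker
      (LerayModel.lerayTransform β : LerayModel.L2S β →ₗ[ℂ] LerayModel.L2S β)) g
    have haC : (a : ℂ) ≠ 0 := by exact_mod_cast ha0.ne'
    refine ⟨(a : ℂ)⁻¹ • ⟨f, hf⟩, ?_⟩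
    simp only
    rw [map_smul, smul_inv_smul₀ haC]
    have hfg : LerayModel.lerayTransform β f = LerayModel.lerayTransform β g := by
      rw [hg, map_add, show LerayModel.lerayTransform β k = 0 from hk, zero_add]
    exact Subtype.ext hfg
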